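/- **Types.** Both calculi use the types $\tau ::= \mathrm{Unit}\mid \mathrm{Bool}\mid \tau^s\to\tau^s\mid \tau^s\times\tau^s\mid \tau^s\uplus\tau^s\mid \mu\alpha.\tau$ with $\tau^s ::= \alpha\mid\tau$ (so recursive types are contractive). All types that occur in terms and in typing derivations are closed. **The iso-recursive calculus $\lambda^\mu_I$.** Terms are $$t ::= \mathtt{unit}\mid\mathtt{true}\mid\mathtt{false}\mid x\mid \lambda x{:}\tau.\,t\mid t\,t\mid t.1\mid t.2\mid\langle t,t\rangle\mid \mathtt{inl}\,t\mid\mathtt{inr}\,t\mid \mathtt{case}\ t\ \mathtt{of}\ \mathtt{inl}\,x_1\mapsto t\mid \mathtt{inr}\,x_2\mapsto t\mid \mathtt{if}\ t\ \mathtt{then}\ t\ \mathtt{else}\ t\mid t;t\mid \mathtt{fold}_{\mu\alpha.\tau}\,t\mid \mathtt{unfold}_{\mu\alpha.\tau}\,t .$$ Typing $\Gamma\vdash t:\tau$ is that of the simply typed $\lambda$-calculus with unit, booleans, products and sums, together with: $\Gamma\vdash \mathtt{fold}_{\mu\alpha.\tau}\,t:\mu\alpha.\tau$ if $\Gamma\vdash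 t:\tau[\mu\alpha.\tau/\alpha]$, and $\Gamma\vdash \mathtt{unfold}_{\mu\alpha.\tau}\,t:\tau[\mu\alpha.\tau/\alpha]$ if $\Gamma\vdash t:\mu\alpha.\tau$. Values are $\mathtt{unit}$, $\mathtt{true}$, $\mathtt{false}$, abstractions, pairs of values, $\mathtt{inl}\,v$, $\mathtt{inr}\,v$ and $\mathtt{fold}_{\mu\alpha.\tau}\,v$. Reduction is small-step, call-by-value and left-to-right (primitive reductions inside evaluation contexts), with the usual rules and $\mathtt{unfold}_{\mu\alpha.\tau}(\mathtt{fold}_{\mu\alpha.\tau}\,v)\to v$. **The equi-recursive calculus $\lambda^\mu_E$.** It has the same syntax, typing and reduction without $\mathtt{fold}$ and $\mathtt{unfold}$, and the additional typing rule: if $\Gamma\vdash t:\tau$ and $\tau\doteq\sigma$, then $\Gamma\vdash t:\sigma$. Here $\doteq$ is the coinductive type equality, the greatest relation such that every pair in it is the conclusion of one of the following rules with premises again in the relation: $\iota\doteq\iota$ for $\iota\in\{\mathrm{Unit},\mathrm{Bool}\}$; $\alpha\doteq\alpha$; $\tau_1\star\tau_2\doteq\sigma_1\star\sigma_2$ from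 $\tau_1\doteq\sigma_1$ and $\tau_2\doteq\sigma_2$, for $\star\in\{\to,\times,\uplus\}$; $\mu\alpha.\tau\doteq\sigma$ from $\tau[\mu\alpha.\tau/\alpha]\doteq\sigma$; $\tau\doteq\mu\alpha.\sigma$ from $\tau\doteq\sigma[\mu\alpha.\sigma/\alpha]$, when $\tau$ is not a $\mu$-type. **Contextual equivalence.** In each calculus, a program context $\mathfrak C$ is a term with exactly one hole, and $\vdash\mathfrak C:\Gamma,\tau\to\Gamma',\tau'$ is the usual context typing: the hole, taken at type $\tau$ in environment $\Gamma$, is typed like a term, and the whole has type $\tau'$ in environment $\Gamma'$ (in $\lambda^\mu_E$, contexts also have the rule that replaces the result type by an equal one). Write $t\Downarrow$ if $t$ reduces to a value in some number of steps. Then $$\Gamma\vdash t_1\simeq_{ctx} t_2:\tau$$ means that $\Gamma\vdash t_1:\tau$, $\Gamma\vdash t_2:\tau$, and, for all $\mathfrak C$ and $\tau'$ with $\vdash\mathfrak C:\Gamma,\tau\to\emptyset,\tau'$, $\mathfrak C[t_1]\Downarrow$ if and only if $\mathfrak C[t_2]\Downarrow$. **Compiler.** Let $[\![\cdot]\!]$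 be the map from $\lambda^\mu_I$-terms to $\lambda^\mu_E$-terms with $[\![\mathtt{fold}_{\mu\alpha.\tau}\,t]\!]=[\![\mathtt{unfold}_{\mu\alpha.\tau}\,t]\!]=[\![t]\!]$ that commutes with all other term constructors and leaves types unchanged. **Theorem.** The compiler $[\![\cdot]\!]$ is fully abstract: for every type $\tau$ and all $\lambda^\mu_I$-terms $t_1,t_2$ with $\emptyset\vdash t_1:\tau$ and $\emptyset\vdash t_2:\tau$, $$\emptyset\vdash t_1\simeq_{ctx} t_2:\tau\ \text{ in }\lambda^\mu_I\quad\Longleftrightarrow\quad \emptyset\vdash [\![t_1]\!]\simeq_{ctx} [\![t_2]\!]:\tau\ \text{ in }\lambda^\mu_E .$$ -/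

import Mathlib

/-! ## Types

Types are shared by both calculi.  Type variables are de Bruijn indices, `mu τ` is `μ α. τ`
with `α` bound as index `0` in `τ`. -/

inductive Ty : Type
  | unit : Ty
  | bool : Ty
  | arr : Ty → Ty → Ty
  | prod : Ty → Ty → Ty
  | sum : Ty → Ty → Ty
  | mu : Ty → Ty
  | var : ℕ → Ty

/-- Lifting of a renaming of de Bruijn indices under one binder. -/
def liftRen (ξ : ℕ → ℕ) : ℕ → ℕ
  | 0 => 0
  | n + 1 => ξ n + 1

namespace Ty

def rename : (ℕ → ℕ) → Ty → Ty
  | _, unit => unit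
  | _, bool => bool
  | ξ, arr a b => arr (rename ξ a) (rename ξ b)
  | ξ, prod a b => prod (rename ξ a) (rename ξ b)
  | ξ, sum a b => sum (rename ξ a) (rename ξ b)
  | ξ, mu a => mu (rename (liftRen ξ) a)
  | ξ, var n => var (ξ n)

/-- Lifting of a simultaneous substitution under one binder. -/
def liftSub (s : ℕ → Ty) : ℕ → Ty
  | 0 => var 0
  | n + 1 => rename Nat.succ (s n)

/-- Capture-avoiding simultaneous substitution. -/
def subst : (ℕ → Ty) → Ty → Ty
  | _, unit => unit
  | _, bool => bool
  | s, arr a b => arr (subst s a) (subst s b)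
  | s, prod a b => prod (subst s a) (subst s b)
  | s, sum a b => sum (subst s a) (subst s b)
  | s, mu a => mu (subst (liftSub s) a)
  | s, var n => s n

/-- The substitution that replaces index `0` by `σ` and lowers the other indices. -/
def single (σ : Ty) : ℕ → Ty
  | 0 => σ
  | n + 1 => var n

/-- For the body `τ` of `μ α. τ`, the unfolding `τ[μ α. τ / α]`. -/
def unfoldMu (τ : Ty) : Ty := subst (single (mu τ)) τ

/-- All free indices are smaller than `k`. -/
def ClosedAt : ℕ → Ty → Prop
  | _, unit => True
  | _, bool => True
  | k, arr a b => ClosedAt k a ∧ ClosedAt k b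
  | k, prod a b => ClosedAt k a ∧ ClosedAt k b
  | k, sum a b => ClosedAt k a ∧ ClosedAt k b
  | k, mu a => ClosedAt (k + 1) a
  | k, var n => n < k

/-- The type is a variable. -/
def IsVar (τ : Ty) : Prop := ∃ n, τ = var n

/-- The type is of the form `μ α. σ`. -/
def IsMu (τ : Ty) : Prop := ∃ σ, τ = mu σ

/-- The type is generated by the grammar
`τ ::= Unit | Bool | τˢ → τˢ | τˢ × τˢ | τˢ ⊎ τˢ | μ α. τ`, `τˢ ::= α | τ`
of contractive types: variables occur only directly below `→`, `×` or `⊎`. -/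
def Contractive : Ty → Prop
  | unit => True
  | bool => True
  | arr a b => (IsVar a ∨ Contractive a) ∧ (IsVar b ∨ Contractive b)
  | prod a b => (IsVar a ∨ Contractive a) ∧ (IsVar b ∨ Contractive b)
  | sum a b => (IsVar a ∨ Contractive a) ∧ (IsVar b ∨ Contractive b)
  | mu a => Contractive a
  | var _ => False

/-- Closed contractive types: the types that both type systems use. -/
def Valid (τ : Ty) : Prop := ClosedAt 0 τ ∧ Contractive τ

/-- One step of the coinductive rules of type equality, with premises in `R`. -/
inductive EqStep (R : Ty → Ty → Prop) : Ty → Ty → Prop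
  | unit : EqStep R unit unit
  | bool : EqStep R bool bool
  | var (n : ℕ) : EqStep R (var n) (var n)
  | arr {a b a' b' : Ty} : R a a' → R b b' → EqStep R (arr a b) (arr a' b')
  | prod {a b a' b' : Ty} : R a a' → R b b' → EqStep R (prod a b) (prod a' b')
  | sum {a b a' b' : Ty} : R a a' → R b b' → EqStep R (sum a b) (sum a' b')
  | muL {τ σ : Ty} : R (unfoldMu τ) σ → EqStep R (mu τ) σ
  | muR {τ σ : Ty} : ¬ IsMu τ → R τ (unfoldMu σ) → EqStep R τ (mu σ)

/-- Coinductive type equality: the greatest relation closed backwards under the rules. -/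
def Equal (τ σ : Ty) : Prop :=
  ∃ R : Ty → Ty → Prop, (∀ a b, R a b → EqStep R a b) ∧ R τ σ

end Ty

/-- Typing environments: index `n` has the type in position `n`. -/
abbrev TyEnv := List Ty

/-! ## The calculus with iso-recursive types -/

namespace Iso

/-- Terms; term variables are de Bruijn indices. `lam` and both branches of `case` bind one
variable. -/
inductive Tm : Type
  | unit : Tm
  | true : Tm
  | false : Tm
  | var : ℕ → Tm
  | lam : Ty → Tm → Tm
  | app : Tm → Tm → Tm
  | fst : Tm → Tm
  | snd : Tm → Tm
  | pair : Tm → Tm → Tm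
  | inl : Tm → Tm
  | inr : Tm → Tm
  | case : Tm → Tm → Tm → Tm
  | ite : Tm → Tm → Tm → Tm
  | seq : Tm → Tm → Tm
    -- `fold τ t` and `unfold τ t` carry the annotation `μ α. τ`; `τ` is the body of it.
  | fold : Ty → Tm → Tm
  | unfold : Ty → Tm → Tm

namespace Tm

def rename : (ℕ → ℕ) → Tm → Tm
  | _, unit => unit
  | _, true => true
  | _, false => false
  | ξ, var n => var (ξ n)
  | ξ, lam τ t => lam τ (rename (liftRen ξ) t)
  | ξ, app t u => app (rename ξ t) (rename ξ u)
  | ξ, fst t => fst (rename ξ t)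
  | ξ, snd t => snd (rename ξ t)
  | ξ, pair t u => pair (rename ξ t) (rename ξ u)
  | ξ, inl t => inl (rename ξ t)
  | ξ, inr t => inr (rename ξ t)
  | ξ, case t u w => case (rename ξ t) (rename (liftRen ξ) u) (rename (liftRen ξ) w)
  | ξ, ite t u w => ite (rename ξ t) (rename ξ u) (rename ξ w)
  | ξ, seq t u => seq (rename ξ t) (rename ξ u)
  | ξ, fold τ t => fold τ (rename ξ t)
  | ξ, unfold τ t => unfold τ (rename ξ t)

def liftSub (s : ℕ → Tm) : ℕ → Tm
  | 0 => var 0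
  | n + 1 => rename Nat.succ (s n)

/-- Capture-avoiding simultaneous substitution. -/
def subst : (ℕ → Tm) → Tm → Tm
  | _, unit => unit
  | _, true => true
  | _, false => false
  | s, var n => s n
  | s, lam τ t => lam τ (subst (liftSub s) t)
  | s, app t u => app (subst s t) (subst s u)
  | s, fst t => fst (subst s t)
  | s, snd t => snd (subst s t)
  | s, pair t u => pair (subst s t) (subst s u)
  | s, inl t => inl (subst s t)
  | s, inr t => inr (subst s t)
  | s, case t u w => case (subst s t) (subst (liftSub s) u) (subst (liftSub s) w)
  | s, ite t u w => ite (subst s t) (subst s u) (subst s w)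
  | s, seq t u => seq (subst s t) (subst s u)
  | s, fold τ t => fold τ (subst s t)
  | s, unfold τ t => unfold τ (subst s t)

def single (v : Tm) : ℕ → Tm
  | 0 => v
  | n + 1 => var n

/-- `t[v / x]`, where `x` is index `0` of `t`. -/
def inst (t v : Tm) : Tm := subst (single v) t

end Tm

/-- Values. -/
inductive IsValue : Tm → Prop
  | unit : IsValue .unit
  | true : IsValue .true
  | false : IsValue .false
  | lam (τ : Ty) (t : Tm) : IsValue (.lam τ t)
  | pair {v w : Tm} : IsValue v → IsValue w → IsValue (.pair v w)
  | inl {v : Tm} : IsValue v → IsValue (.inl v)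
  | inr {v : Tm} : IsValue v → IsValue (.inr v)
  | fold {τ : Ty} {v : Tm} : IsValue v → IsValue (.fold τ v)

/-- Program contexts: terms with exactly one hole. -/
inductive Ctx : Type
  | hole : Ctx
  | lam : Ty → Ctx → Ctx
  | app₁ : Ctx → Tm → Ctx
  | app₂ : Tm → Ctx → Ctx
  | fst : Ctx → Ctx
  | snd : Ctx → Ctx
  | pair₁ : Ctx → Tm → Ctx
  | pair₂ : Tm → Ctx → Ctx
  | case₁ : Ctx → Tm → Tm → Ctx
  | case₂ : Tm → Ctx → Tm → Ctx
  | case₃ : Tm → Tm → Ctx → Ctx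
  | inl : Ctx → Ctx
  | inr : Ctx → Ctx
  | seq₁ : Ctx → Tm → Ctx
  | seq₂ : Tm → Ctx → Ctx
  | ite₁ : Ctx → Tm → Tm → Ctx
  | ite₂ : Tm → Ctx → Tm → Ctx
  | ite₃ : Tm → Tm → Ctx → Ctx
  | fold : Ty → Ctx → Ctx
  | unfold : Ty → Ctx → Ctx

namespace Ctx

/-- Plugging a term into the hole (possibly capturing its free variables). -/
def fill : Ctx → Tm → Tm
  | hole, t => t
  | lam τ C, t => .lam τ (fill C t)
  | app₁ C u, t => .app (fill C t) u
  | app₂ u C, t => .app u (fill C t)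
  | fst C, t => .fst (fill C t)
  | snd C, t => .snd (fill C t)
  | pair₁ C u, t => .pair (fill C t) u
  | pair₂ u C, t => .pair u (fill C t)
  | case₁ C u w, t => .case (fill C t) u w
  | case₂ u C w, t => .case u (fill C t) w
  | case₃ u w C, t => .case u w (fill C t)
  | inl C, t => .inl (fill C t)
  | inr C, t => .inr (fill C t)
  | seq₁ C u, t => .seq (fill C t) u
  | seq₂ u C, t => .seq u (fill C t)
  | ite₁ C u w, t => .ite (fill C t) u w
  | ite₂ u C w, t => .ite u (fill C t) w
  | ite₃ u w C, t => .ite u w (fill C t)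
  | fold τ C, t => .fold τ (fill C t)
  | unfold τ C, t => .unfold τ (fill C t)

/-- The program contexts that are (call-by-value, left-to-right) evaluation contexts. -/
inductive IsEval : Ctx → Prop
  | hole : IsEval hole
  | app₁ {E : Ctx} {t : Tm} : IsEval E → IsEval (app₁ E t)
  | app₂ {v : Tm} {E : Ctx} : IsValue v → IsEval E → IsEval (app₂ v E)
  | fst {E : Ctx} : IsEval E → IsEval (fst E)
  | snd {E : Ctx} : IsEval E → IsEval (snd E)
  | pair₁ {E : Ctx} {t : Tm} : IsEval E → IsEval (pair₁ E t)
  | pair₂ {v : Tm} {E : Ctx} : IsValue v → IsEval E → IsEval (pair₂ v E)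
  | case₁ {E : Ctx} {t u : Tm} : IsEval E → IsEval (case₁ E t u)
  | inl {E : Ctx} : IsEval E → IsEval (inl E)
  | inr {E : Ctx} : IsEval E → IsEval (inr E)
  | seq₁ {E : Ctx} {t : Tm} : IsEval E → IsEval (seq₁ E t)
  | ite₁ {E : Ctx} {t u : Tm} : IsEval E → IsEval (ite₁ E t u)
  | fold {τ : Ty} {E : Ctx} : IsEval E → IsEval (fold τ E)
  | unfold {τ : Ty} {E : Ctx} : IsEval E → IsEval (unfold τ E)

end Ctx

/-- Typing of terms. -/
inductive HasType : TyEnv → Tm → Ty → Prop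
  | var {Γ : TyEnv} {n : ℕ} {τ : Ty} : Γ[n]? = some τ → HasType Γ (.var n) τ
  | unit {Γ : TyEnv} : HasType Γ .unit .unit
  | true {Γ : TyEnv} : HasType Γ .true .bool
  | false {Γ : TyEnv} : HasType Γ .false .bool
  | lam {Γ : TyEnv} {t : Tm} {τ τ' : Ty} :
      τ.Valid → HasType (τ :: Γ) t τ' → HasType Γ (.lam τ t) (.arr τ τ')
  | app {Γ : TyEnv} {t u : Tm} {τ τ' : Ty} :
      HasType Γ t (.arr τ' τ) → HasType Γ u τ' → HasType Γ (.app t u) τ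
  | fst {Γ : TyEnv} {t : Tm} {τ τ' : Ty} : HasType Γ t (.prod τ τ') → HasType Γ (.fst t) τ
  | snd {Γ : TyEnv} {t : Tm} {τ τ' : Ty} : HasType Γ t (.prod τ τ') → HasType Γ (.snd t) τ'
  | pair {Γ : TyEnv} {t u : Tm} {τ τ' : Ty} :
      HasType Γ t τ → HasType Γ u τ' → HasType Γ (.pair t u) (.prod τ τ')
  | inl {Γ : TyEnv} {t : Tm} {τ τ' : Ty} :
      τ'.Valid → HasType Γ t τ → HasType Γ (.inl t) (.sum τ τ')
  | inr {Γ : TyEnv} {t : Tm} {τ τ' : Ty} :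
      τ.Valid → HasType Γ t τ' → HasType Γ (.inr t) (.sum τ τ')
  | case {Γ : TyEnv} {t u w : Tm} {τ₁ τ₂ τ : Ty} :
      HasType Γ t (.sum τ₁ τ₂) → HasType (τ₁ :: Γ) u τ → HasType (τ₂ :: Γ) w τ →
      HasType Γ (.case t u w) τ
  | ite {Γ : TyEnv} {t u w : Tm} {τ : Ty} :
      HasType Γ t .bool → HasType Γ u τ → HasType Γ w τ → HasType Γ (.ite t u w) τ
  | seq {Γ : TyEnv} {t u : Tm} {τ : Ty} :
      HasType Γ t .unit → HasType Γ u τ → HasType Γ (.seq t u) τ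
  | fold {Γ : TyEnv} {t : Tm} {τ : Ty} :
      (Ty.mu τ).Valid → HasType Γ t τ.unfoldMu → HasType Γ (.fold τ t) (.mu τ)
  | unfold {Γ : TyEnv} {t : Tm} {τ : Ty} :
      (Ty.mu τ).Valid → HasType Γ t (.mu τ) → HasType Γ (.unfold τ t) τ.unfoldMu

/-- Typing of program contexts: in `CtxType Γ₀ τ₀ C Γ τ` the hole of `C` takes terms of type `τ₀`
in environment `Γ₀`, and the resulting term has type `τ` in environment `Γ`. -/
inductive CtxType (Γ₀ : TyEnv) (τ₀ : Ty) : Ctx → TyEnv → Ty → Prop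
  | hole : CtxType Γ₀ τ₀ .hole Γ₀ τ₀
  | lam {C : Ctx} {Γ : TyEnv} {τ τ' : Ty} :
      τ.Valid → CtxType Γ₀ τ₀ C (τ :: Γ) τ' → CtxType Γ₀ τ₀ (.lam τ C) Γ (.arr τ τ')
  | app₁ {C : Ctx} {Γ : TyEnv} {u : Tm} {τ τ' : Ty} :
      CtxType Γ₀ τ₀ C Γ (.arr τ' τ) → HasType Γ u τ' → CtxType Γ₀ τ₀ (.app₁ C u) Γ τ
  | app₂ {C : Ctx} {Γ : TyEnv} {t : Tm} {τ τ' : Ty} :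
      HasType Γ t (.arr τ' τ) → CtxType Γ₀ τ₀ C Γ τ' → CtxType Γ₀ τ₀ (.app₂ t C) Γ τ
  | fst {C : Ctx} {Γ : TyEnv} {τ τ' : Ty} :
      CtxType Γ₀ τ₀ C Γ (.prod τ τ') → CtxType Γ₀ τ₀ (.fst C) Γ τ
  | snd {C : Ctx} {Γ : TyEnv} {τ τ' : Ty} :
      CtxType Γ₀ τ₀ C Γ (.prod τ τ') → CtxType Γ₀ τ₀ (.snd C) Γ τ'
  | pair₁ {C : Ctx} {Γ : TyEnv} {u : Tm} {τ τ' : Ty} :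
      CtxType Γ₀ τ₀ C Γ τ → HasType Γ u τ' → CtxType Γ₀ τ₀ (.pair₁ C u) Γ (.prod τ τ')
  | pair₂ {C : Ctx} {Γ : TyEnv} {t : Tm} {τ τ' : Ty} :
      HasType Γ t τ → CtxType Γ₀ τ₀ C Γ τ' → CtxType Γ₀ τ₀ (.pair₂ t C) Γ (.prod τ τ')
  | case₁ {C : Ctx} {Γ : TyEnv} {u w : Tm} {τ₁ τ₂ τ : Ty} :
      CtxType Γ₀ τ₀ C Γ (.sum τ₁ τ₂) → HasType (τ₁ :: Γ) u τ → HasType (τ₂ :: Γ) w τ →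
      CtxType Γ₀ τ₀ (.case₁ C u w) Γ τ
  | case₂ {C : Ctx} {Γ : TyEnv} {t w : Tm} {τ₁ τ₂ τ : Ty} :
      HasType Γ t (.sum τ₁ τ₂) → CtxType Γ₀ τ₀ C (τ₁ :: Γ) τ → HasType (τ₂ :: Γ) w τ →
      CtxType Γ₀ τ₀ (.case₂ t C w) Γ τ
  | case₃ {C : Ctx} {Γ : TyEnv} {t u : Tm} {τ₁ τ₂ τ : Ty} :
      HasType Γ t (.sum τ₁ τ₂) → HasType (τ₁ :: Γ) u τ → CtxType Γ₀ τ₀ C (τ₂ :: Γ) τ →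
      CtxType Γ₀ τ₀ (.case₃ t u C) Γ τ
  | inl {C : Ctx} {Γ : TyEnv} {τ τ' : Ty} :
      τ'.Valid → CtxType Γ₀ τ₀ C Γ τ → CtxType Γ₀ τ₀ (.inl C) Γ (.sum τ τ')
  | inr {C : Ctx} {Γ : TyEnv} {τ τ' : Ty} :
      τ.Valid → CtxType Γ₀ τ₀ C Γ τ' → CtxType Γ₀ τ₀ (.inr C) Γ (.sum τ τ')
  | seq₁ {C : Ctx} {Γ : TyEnv} {u : Tm} {τ : Ty} :
      CtxType Γ₀ τ₀ C Γ .unit → HasType Γ u τ → CtxType Γ₀ τ₀ (.seq₁ C u) Γ τ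
  | seq₂ {C : Ctx} {Γ : TyEnv} {t : Tm} {τ : Ty} :
      HasType Γ t .unit → CtxType Γ₀ τ₀ C Γ τ → CtxType Γ₀ τ₀ (.seq₂ t C) Γ τ
  | ite₁ {C : Ctx} {Γ : TyEnv} {u w : Tm} {τ : Ty} :
      CtxType Γ₀ τ₀ C Γ .bool → HasType Γ u τ → HasType Γ w τ →
      CtxType Γ₀ τ₀ (.ite₁ C u w) Γ τ
  | ite₂ {C : Ctx} {Γ : TyEnv} {t w : Tm} {τ : Ty} :
      HasType Γ t .bool → CtxType Γ₀ τ₀ C Γ τ → HasType Γ w τ →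
      CtxType Γ₀ τ₀ (.ite₂ t C w) Γ τ
  | ite₃ {C : Ctx} {Γ : TyEnv} {t u : Tm} {τ : Ty} :
      HasType Γ t .bool → HasType Γ u τ → CtxType Γ₀ τ₀ C Γ τ →
      CtxType Γ₀ τ₀ (.ite₃ t u C) Γ τ
  | fold {C : Ctx} {Γ : TyEnv} {τ : Ty} :
      (Ty.mu τ).Valid → CtxType Γ₀ τ₀ C Γ τ.unfoldMu → CtxType Γ₀ τ₀ (.fold τ C) Γ (.mu τ)
  | unfold {C : Ctx} {Γ : TyEnv} {τ : Ty} :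
      (Ty.mu τ).Valid → CtxType Γ₀ τ₀ C Γ (.mu τ) → CtxType Γ₀ τ₀ (.unfold τ C) Γ τ.unfoldMu

/-- Primitive reductions. -/
inductive PrimStep : Tm → Tm → Prop
  | beta {τ : Ty} {t v : Tm} : IsValue v → PrimStep (.app (.lam τ t) v) (t.inst v)
  | fst {v w : Tm} : IsValue v → IsValue w → PrimStep (.fst (.pair v w)) v
  | snd {v w : Tm} : IsValue v → IsValue w → PrimStep (.snd (.pair v w)) w
  | seq {t : Tm} : PrimStep (.seq .unit t) t
  | inl {v t u : Tm} : IsValue v → PrimStep (.case (.inl v) t u) (t.inst v)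
  | inr {v t u : Tm} : IsValue v → PrimStep (.case (.inr v) t u) (u.inst v)
  | iteTrue {t u : Tm} : PrimStep (.ite .true t u) t
  | iteFalse {t u : Tm} : PrimStep (.ite .false t u) u
  | unfoldFold {τ : Ty} {v : Tm} : IsValue v → PrimStep (.unfold τ (.fold τ v)) v

/-- Small-step reduction: a primitive reduction inside an evaluation context. -/
inductive Step : Tm → Tm → Prop
  | ctx {E : Ctx} {t t' : Tm} : E.IsEval → PrimStep t t' → Step (E.fill t) (E.fill t')

/-- `EvalsIn t n v`: the term `t` reduces to the value `v` in `n` steps. -/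
inductive EvalsIn : Tm → ℕ → Tm → Prop
  | value {v : Tm} : IsValue v → EvalsIn v 0 v
  | step {t t' v : Tm} {n : ℕ} : Step t t' → EvalsIn t' n v → EvalsIn t (n + 1) v

/-- Termination. -/
def Terminates (t : Tm) : Prop := ∃ (n : ℕ) (v : Tm), EvalsIn t n v

/-- Contextual equivalence of `t₁` and `t₂` at type `τ` in environment `Γ`. -/
def CtxEquiv (Γ : TyEnv) (t₁ t₂ : Tm) (τ : Ty) : Prop :=
  HasType Γ t₁ τ ∧ HasType Γ t₂ τ ∧
    ∀ (C : Ctx) (τ' : Ty), CtxType Γ τ C [] τ' →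
      (Terminates (C.fill t₁) ↔ Terminates (C.fill t₂))

end Iso

/-! ## The calculus with coinductive equi-recursive types -/

namespace Equi

/-- Terms; term variables are de Bruijn indices. `lam` and both branches of `case` bind one
variable. -/
inductive Tm : Type
  | unit : Tm
  | true : Tm
  | false : Tm
  | var : ℕ → Tm
  | lam : Ty → Tm → Tm
  | app : Tm → Tm → Tm
  | fst : Tm → Tm
  | snd : Tm → Tm
  | pair : Tm → Tm → Tm
  | inl : Tm → Tm
  | inr : Tm → Tm
  | case : Tm → Tm → Tm → Tm
  | ite : Tm → Tm → Tm → Tm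
  | seq : Tm → Tm → Tm

namespace Tm

def rename : (ℕ → ℕ) → Tm → Tm
  | _, unit => unit
  | _, true => true
  | _, false => false
  | ξ, var n => var (ξ n)
  | ξ, lam τ t => lam τ (rename (liftRen ξ) t)
  | ξ, app t u => app (rename ξ t) (rename ξ u)
  | ξ, fst t => fst (rename ξ t)
  | ξ, snd t => snd (rename ξ t)
  | ξ, pair t u => pair (rename ξ t) (rename ξ u)
  | ξ, inl t => inl (rename ξ t)
  | ξ, inr t => inr (rename ξ t)
  | ξ, case t u w => case (rename ξ t) (rename (liftRen ξ) u) (rename (liftRen ξ) w)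
  | ξ, ite t u w => ite (rename ξ t) (rename ξ u) (rename ξ w)
  | ξ, seq t u => seq (rename ξ t) (rename ξ u)

def liftSub (s : ℕ → Tm) : ℕ → Tm
  | 0 => var 0
  | n + 1 => rename Nat.succ (s n)

/-- Capture-avoiding simultaneous substitution. -/
def subst : (ℕ → Tm) → Tm → Tm
  | _, unit => unit
  | _, true => true
  | _, false => false
  | s, var n => s n
  | s, lam τ t => lam τ (subst (liftSub s) t)
  | s, app t u => app (subst s t) (subst s u)
  | s, fst t => fst (subst s t)
  | s, snd t => snd (subst s t)
  | s, pair t u => pair (subst s t) (subst s u)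
  | s, inl t => inl (subst s t)
  | s, inr t => inr (subst s t)
  | s, case t u w => case (subst s t) (subst (liftSub s) u) (subst (liftSub s) w)
  | s, ite t u w => ite (subst s t) (subst s u) (subst s w)
  | s, seq t u => seq (subst s t) (subst s u)

def single (v : Tm) : ℕ → Tm
  | 0 => v
  | n + 1 => var n

/-- `t[v / x]`, where `x` is index `0` of `t`. -/
def inst (t v : Tm) : Tm := subst (single v) t

end Tm

/-- Values. -/
inductive IsValue : Tm → Prop
  | unit : IsValue .unit
  | true : IsValue .true
  | false : IsValue .false
  | lam (τ : Ty) (t : Tm) : IsValue (.lam τ t)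
  | pair {v w : Tm} : IsValue v → IsValue w → IsValue (.pair v w)
  | inl {v : Tm} : IsValue v → IsValue (.inl v)
  | inr {v : Tm} : IsValue v → IsValue (.inr v)

/-- Program contexts: terms with exactly one hole. -/
inductive Ctx : Type
  | hole : Ctx
  | lam : Ty → Ctx → Ctx
  | app₁ : Ctx → Tm → Ctx
  | app₂ : Tm → Ctx → Ctx
  | fst : Ctx → Ctx
  | snd : Ctx → Ctx
  | pair₁ : Ctx → Tm → Ctx
  | pair₂ : Tm → Ctx → Ctx
  | case₁ : Ctx → Tm → Tm → Ctx
  | case₂ : Tm → Ctx → Tm → Ctx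
  | case₃ : Tm → Tm → Ctx → Ctx
  | inl : Ctx → Ctx
  | inr : Ctx → Ctx
  | seq₁ : Ctx → Tm → Ctx
  | seq₂ : Tm → Ctx → Ctx
  | ite₁ : Ctx → Tm → Tm → Ctx
  | ite₂ : Tm → Ctx → Tm → Ctx
  | ite₃ : Tm → Tm → Ctx → Ctx

namespace Ctx

/-- Plugging a term into the hole (possibly capturing its free variables). -/
def fill : Ctx → Tm → Tm
  | hole, t => t
  | lam τ C, t => .lam τ (fill C t)
  | app₁ C u, t => .app (fill C t) u
  | app₂ u C, t => .app u (fill C t)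
  | fst C, t => .fst (fill C t)
  | snd C, t => .snd (fill C t)
  | pair₁ C u, t => .pair (fill C t) u
  | pair₂ u C, t => .pair u (fill C t)
  | case₁ C u w, t => .case (fill C t) u w
  | case₂ u C w, t => .case u (fill C t) w
  | case₃ u w C, t => .case u w (fill C t)
  | inl C, t => .inl (fill C t)
  | inr C, t => .inr (fill C t)
  | seq₁ C u, t => .seq (fill C t) u
  | seq₂ u C, t => .seq u (fill C t)
  | ite₁ C u w, t => .ite (fill C t) u w
  | ite₂ u C w, t => .ite u (fill C t) w
  | ite₃ u w C, t => .ite u w (fill C t)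

/-- The program contexts that are (call-by-value, left-to-right) evaluation contexts. -/
inductive IsEval : Ctx → Prop
  | hole : IsEval hole
  | app₁ {E : Ctx} {t : Tm} : IsEval E → IsEval (app₁ E t)
  | app₂ {v : Tm} {E : Ctx} : IsValue v → IsEval E → IsEval (app₂ v E)
  | fst {E : Ctx} : IsEval E → IsEval (fst E)
  | snd {E : Ctx} : IsEval E → IsEval (snd E)
  | pair₁ {E : Ctx} {t : Tm} : IsEval E → IsEval (pair₁ E t)
  | pair₂ {v : Tm} {E : Ctx} : IsValue v → IsEval E → IsEval (pair₂ v E)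
  | case₁ {E : Ctx} {t u : Tm} : IsEval E → IsEval (case₁ E t u)
  | inl {E : Ctx} : IsEval E → IsEval (inl E)
  | inr {E : Ctx} : IsEval E → IsEval (inr E)
  | seq₁ {E : Ctx} {t : Tm} : IsEval E → IsEval (seq₁ E t)
  | ite₁ {E : Ctx} {t u : Tm} : IsEval E → IsEval (ite₁ E t u)

end Ctx

/-- Typing of terms. -/
inductive HasType : TyEnv → Tm → Ty → Prop
  | var {Γ : TyEnv} {n : ℕ} {τ : Ty} : Γ[n]? = some τ → HasType Γ (.var n) τ
  | unit {Γ : TyEnv} : HasType Γ .unit .unit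
  | true {Γ : TyEnv} : HasType Γ .true .bool
  | false {Γ : TyEnv} : HasType Γ .false .bool
  | lam {Γ : TyEnv} {t : Tm} {τ τ' : Ty} :
      τ.Valid → HasType (τ :: Γ) t τ' → HasType Γ (.lam τ t) (.arr τ τ')
  | app {Γ : TyEnv} {t u : Tm} {τ τ' : Ty} :
      HasType Γ t (.arr τ' τ) → HasType Γ u τ' → HasType Γ (.app t u) τ
  | fst {Γ : TyEnv} {t : Tm} {τ τ' : Ty} : HasType Γ t (.prod τ τ') → HasType Γ (.fst t) τ
  | snd {Γ : TyEnv} {t : Tm} {τ τ' : Ty} : HasType Γ t (.prod τ τ') → HasType Γ (.snd t) τ'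
  | pair {Γ : TyEnv} {t u : Tm} {τ τ' : Ty} :
      HasType Γ t τ → HasType Γ u τ' → HasType Γ (.pair t u) (.prod τ τ')
  | inl {Γ : TyEnv} {t : Tm} {τ τ' : Ty} :
      τ'.Valid → HasType Γ t τ → HasType Γ (.inl t) (.sum τ τ')
  | inr {Γ : TyEnv} {t : Tm} {τ τ' : Ty} :
      τ.Valid → HasType Γ t τ' → HasType Γ (.inr t) (.sum τ τ')
  | case {Γ : TyEnv} {t u w : Tm} {τ₁ τ₂ τ : Ty} :
      HasType Γ t (.sum τ₁ τ₂) → HasType (τ₁ :: Γ) u τ → HasType (τ₂ :: Γ) w τ →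
      HasType Γ (.case t u w) τ
  | ite {Γ : TyEnv} {t u w : Tm} {τ : Ty} :
      HasType Γ t .bool → HasType Γ u τ → HasType Γ w τ → HasType Γ (.ite t u w) τ
  | seq {Γ : TyEnv} {t u : Tm} {τ : Ty} :
      HasType Γ t .unit → HasType Γ u τ → HasType Γ (.seq t u) τ
  | eq {Γ : TyEnv} {t : Tm} {τ σ : Ty} :
      σ.Valid → HasType Γ t τ → τ.Equal σ → HasType Γ t σ

/-- Typing of program contexts: in `CtxType Γ₀ τ₀ C Γ τ` the hole of `C` takes terms of type `τ₀`
in environment `Γ₀`, and the resulting term has type `τ` in environment `Γ`. -/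
inductive CtxType (Γ₀ : TyEnv) (τ₀ : Ty) : Ctx → TyEnv → Ty → Prop
  | hole : CtxType Γ₀ τ₀ .hole Γ₀ τ₀
  | lam {C : Ctx} {Γ : TyEnv} {τ τ' : Ty} :
      τ.Valid → CtxType Γ₀ τ₀ C (τ :: Γ) τ' → CtxType Γ₀ τ₀ (.lam τ C) Γ (.arr τ τ')
  | app₁ {C : Ctx} {Γ : TyEnv} {u : Tm} {τ τ' : Ty} :
      CtxType Γ₀ τ₀ C Γ (.arr τ' τ) → HasType Γ u τ' → CtxType Γ₀ τ₀ (.app₁ C u) Γ τ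
  | app₂ {C : Ctx} {Γ : TyEnv} {t : Tm} {τ τ' : Ty} :
      HasType Γ t (.arr τ' τ) → CtxType Γ₀ τ₀ C Γ τ' → CtxType Γ₀ τ₀ (.app₂ t C) Γ τ
  | fst {C : Ctx} {Γ : TyEnv} {τ τ' : Ty} :
      CtxType Γ₀ τ₀ C Γ (.prod τ τ') → CtxType Γ₀ τ₀ (.fst C) Γ τ
  | snd {C : Ctx} {Γ : TyEnv} {τ τ' : Ty} :
      CtxType Γ₀ τ₀ C Γ (.prod τ τ') → CtxType Γ₀ τ₀ (.snd C) Γ τ'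
  | pair₁ {C : Ctx} {Γ : TyEnv} {u : Tm} {τ τ' : Ty} :
      CtxType Γ₀ τ₀ C Γ τ → HasType Γ u τ' → CtxType Γ₀ τ₀ (.pair₁ C u) Γ (.prod τ τ')
  | pair₂ {C : Ctx} {Γ : TyEnv} {t : Tm} {τ τ' : Ty} :
      HasType Γ t τ → CtxType Γ₀ τ₀ C Γ τ' → CtxType Γ₀ τ₀ (.pair₂ t C) Γ (.prod τ τ')
  | case₁ {C : Ctx} {Γ : TyEnv} {u w : Tm} {τ₁ τ₂ τ : Ty} :
      CtxType Γ₀ τ₀ C Γ (.sum τ₁ τ₂) → HasType (τ₁ :: Γ) u τ → HasType (τ₂ :: Γ) w τ →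
      CtxType Γ₀ τ₀ (.case₁ C u w) Γ τ
  | case₂ {C : Ctx} {Γ : TyEnv} {t w : Tm} {τ₁ τ₂ τ : Ty} :
      HasType Γ t (.sum τ₁ τ₂) → CtxType Γ₀ τ₀ C (τ₁ :: Γ) τ → HasType (τ₂ :: Γ) w τ →
      CtxType Γ₀ τ₀ (.case₂ t C w) Γ τ
  | case₃ {C : Ctx} {Γ : TyEnv} {t u : Tm} {τ₁ τ₂ τ : Ty} :
      HasType Γ t (.sum τ₁ τ₂) → HasType (τ₁ :: Γ) u τ → CtxType Γ₀ τ₀ C (τ₂ :: Γ) τ →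
      CtxType Γ₀ τ₀ (.case₃ t u C) Γ τ
  | inl {C : Ctx} {Γ : TyEnv} {τ τ' : Ty} :
      τ'.Valid → CtxType Γ₀ τ₀ C Γ τ → CtxType Γ₀ τ₀ (.inl C) Γ (.sum τ τ')
  | inr {C : Ctx} {Γ : TyEnv} {τ τ' : Ty} :
      τ.Valid → CtxType Γ₀ τ₀ C Γ τ' → CtxType Γ₀ τ₀ (.inr C) Γ (.sum τ τ')
  | seq₁ {C : Ctx} {Γ : TyEnv} {u : Tm} {τ : Ty} :
      CtxType Γ₀ τ₀ C Γ .unit → HasType Γ u τ → CtxType Γ₀ τ₀ (.seq₁ C u) Γ τ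
  | seq₂ {C : Ctx} {Γ : TyEnv} {t : Tm} {τ : Ty} :
      HasType Γ t .unit → CtxType Γ₀ τ₀ C Γ τ → CtxType Γ₀ τ₀ (.seq₂ t C) Γ τ
  | ite₁ {C : Ctx} {Γ : TyEnv} {u w : Tm} {τ : Ty} :
      CtxType Γ₀ τ₀ C Γ .bool → HasType Γ u τ → HasType Γ w τ →
      CtxType Γ₀ τ₀ (.ite₁ C u w) Γ τ
  | ite₂ {C : Ctx} {Γ : TyEnv} {t w : Tm} {τ : Ty} :
      HasType Γ t .bool → CtxType Γ₀ τ₀ C Γ τ → HasType Γ w τ →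
      CtxType Γ₀ τ₀ (.ite₂ t C w) Γ τ
  | ite₃ {C : Ctx} {Γ : TyEnv} {t u : Tm} {τ : Ty} :
      HasType Γ t .bool → HasType Γ u τ → CtxType Γ₀ τ₀ C Γ τ →
      CtxType Γ₀ τ₀ (.ite₃ t u C) Γ τ
  | eq {C : Ctx} {Γ : TyEnv} {τ σ : Ty} :
      σ.Valid → CtxType Γ₀ τ₀ C Γ τ → τ.Equal σ → CtxType Γ₀ τ₀ C Γ σ

/-- Primitive reductions. -/
inductive PrimStep : Tm → Tm → Prop
  | beta {τ : Ty} {t v : Tm} : IsValue v → PrimStep (.app (.lam τ t) v) (t.inst v)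
  | fst {v w : Tm} : IsValue v → IsValue w → PrimStep (.fst (.pair v w)) v
  | snd {v w : Tm} : IsValue v → IsValue w → PrimStep (.snd (.pair v w)) w
  | seq {t : Tm} : PrimStep (.seq .unit t) t
  | inl {v t u : Tm} : IsValue v → PrimStep (.case (.inl v) t u) (t.inst v)
  | inr {v t u : Tm} : IsValue v → PrimStep (.case (.inr v) t u) (u.inst v)
  | iteTrue {t u : Tm} : PrimStep (.ite .true t u) t
  | iteFalse {t u : Tm} : PrimStep (.ite .false t u) u

/-- Small-step reduction: a primitive reduction inside an evaluation context. -/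
inductive Step : Tm → Tm → Prop
  | ctx {E : Ctx} {t t' : Tm} : E.IsEval → PrimStep t t' → Step (E.fill t) (E.fill t')

/-- `EvalsIn t n v`: the term `t` reduces to the value `v` in `n` steps. -/
inductive EvalsIn : Tm → ℕ → Tm → Prop
  | value {v : Tm} : IsValue v → EvalsIn v 0 v
  | step {t t' v : Tm} {n : ℕ} : Step t t' → EvalsIn t' n v → EvalsIn t (n + 1) v

/-- Termination. -/
def Terminates (t : Tm) : Prop := ∃ (n : ℕ) (v : Tm), EvalsIn t n v

/-- Contextual equivalence of `t₁` and `t₂` at type `τ` in environment `Γ`. -/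
def CtxEquiv (Γ : TyEnv) (t₁ t₂ : Tm) (τ : Ty) : Prop :=
  HasType Γ t₁ τ ∧ HasType Γ t₂ τ ∧
    ∀ (C : Ctx) (τ' : Ty), CtxType Γ τ C [] τ' →
      (Terminates (C.fill t₁) ↔ Terminates (C.fill t₂))

end Equi

/-! ## The compiler -/

/-- The compiler from the iso-recursive to the equi-recursive calculus: it erases all `fold` and
`unfold` annotations and leaves everything else, types included, unchanged. -/
def erase : Iso.Tm → Equi.Tm
  | .unit => .unit
  | .true => .true
  | .false => .false
  | .var n => .var n
  | .lam τ t => .lam τ (erase t)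
  | .app t u => .app (erase t) (erase u)
  | .fst t => .fst (erase t)
  | .snd t => .snd (erase t)
  | .pair t u => .pair (erase t) (erase u)
  | .inl t => .inl (erase t)
  | .inr t => .inr (erase t)
  | .case t u w => .case (erase t) (erase u) (erase w)
  | .ite t u w => .ite (erase t) (erase u) (erase w)
  | .seq t u => .seq (erase t) (erase u)
  | .fold _ t => erase t
  | .unfold _ t => erase t

namespace Ty

/-! ## Closed and contractive types -/

/-! The implication from equi-recursive to iso-recursive equivalence is the easy one. An iso-context
is erased, with the equality rule replacing its `fold`s and `unfold`s, and erasure preserves and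
reflects termination of well-typed closed terms (`terminates_erase_iff`).

The converse needs a back-translation of equi-contexts, in which every use of the equality rule
becomes the application of an explicit coercion. Type equality is coinductive, so following a
derivation of it might never end. It is therefore replaced by finite approximations: a coercion of
depth `n` (`IsCast n`) follows the derivation through `n` nested type constructors and may diverge
below that. Contractivity allows only finitely many unrollings between two constructors, so
coercions of every depth exist (`exists_isCast_of_equal`).

A term `t` of the iso-calculus and a term `u` of the equi-calculus are compared by `ErasesTo L t u`:
`u` is `t` without `fold`s, `unfold`s and coercions, and all these coercions have depth at least
`L`. A coerced function evaluates to an eta-expanded wrapper, so the relation also erases wrappers.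
Two asymmetric simulations hold.

(1) If `t` terminates, so does `u`, for every `L`: a coercion that is too shallow can only destroy
termination (`ErasesTo.eval_of_bigStep`).

(2) If `u` terminates, there is a `k` such that every well-typed `t` related to `u` at depth `k`
terminates (`Equi.Eval.exists_reflectsEval`). A terminating run computes finitely many values, and
pushing a coercion through a value costs at most the size of its part outside functions. Coercions
stacked on one value each pay from their own depth, so `k` depends on the run of `u` only and not on
`t`.

This independence closes the argument. If `C[erase s₁]` terminates, (2) gives `k`; the
back-translation `D` of `C` with coercions of depth `k` is chosen afterwards, and `D[s₁]`
terminates. By the assumed equivalence `D[s₂]` terminates, and by (1) so does `C[erase s₂]`. -/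

theorem ClosedAt.mono {τ : Ty} {j k : ℕ} (h : ClosedAt j τ) (hk : j ≤ k) : ClosedAt k τ := by
  induction τ generalizing j k with
  | unit | bool => trivial
  | arr a b iha ihb | prod a b iha ihb | sum a b iha ihb => exact ⟨iha h.1 hk, ihb h.2 hk⟩
  | mu a ih => exact ih (j := j + 1) h (Nat.succ_le_succ hk)
  | var n => exact lt_of_lt_of_le h hk

theorem ClosedAt.rename {τ : Ty} {j k : ℕ} {ξ : ℕ → ℕ} (h : ClosedAt j τ)
    (hξ : ∀ n < j, ξ n < k) : ClosedAt k (rename ξ τ) := by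
  induction τ generalizing j k ξ with
  | unit | bool => trivial
  | arr a b iha ihb | prod a b iha ihb | sum a b iha ihb => exact ⟨iha h.1 hξ, ihb h.2 hξ⟩
  | mu a ih =>
    refine ih (j := j + 1) (k := k + 1) h fun n hn => ?_
    cases n with
    | zero => exact Nat.succ_pos _
    | succ n => exact Nat.succ_lt_succ (hξ n (Nat.lt_of_succ_lt_succ hn))
  | var n => exact hξ n h

theorem ClosedAt.subst {τ : Ty} {j k : ℕ} {s : ℕ → Ty} (h : ClosedAt j τ)
    (hs : ∀ n < j, ClosedAt k (s n)) : ClosedAt k (subst s τ) := by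
  induction τ generalizing j k s with
  | unit | bool => trivial
  | arr a b iha ihb | prod a b iha ihb | sum a b iha ihb => exact ⟨iha h.1 hs, ihb h.2 hs⟩
  | mu a ih =>
    refine ih (j := j + 1) (k := k + 1) h fun n hn => ?_
    cases n with
    | zero => exact Nat.succ_pos _
    | succ n =>
      exact (hs n (Nat.lt_of_succ_lt_succ hn)).rename fun m hm => Nat.succ_lt_succ hm
  | var n => exact hs n h

theorem ClosedAt.subst_eq {τ : Ty} {k : ℕ} {s : ℕ → Ty} (h : ClosedAt k τ)
    (hs : ∀ n < k, s n = var n) : Ty.subst s τ = τ := by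
  induction τ generalizing k s with
  | unit | bool => rfl
  | arr a b iha ihb | prod a b iha ihb | sum a b iha ihb =>
    simp only [Ty.subst, iha h.1 hs, ihb h.2 hs]
  | mu a ih =>
    simp only [Ty.subst]
    rw [ih (k := k + 1) h]
    intro n hn
    cases n with
    | zero => rfl
    | succ n => simp only [liftSub, hs n (Nat.lt_of_succ_lt_succ hn), Ty.rename]
  | var n => exact hs n h

theorem IsVar.rename {τ : Ty} (h : IsVar τ) (ξ : ℕ → ℕ) : IsVar (Ty.rename ξ τ) := by
  obtain ⟨n, rfl⟩ := h
  exact ⟨ξ n, rfl⟩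

theorem Contractive.rename {τ : Ty} (h : Contractive τ) (ξ : ℕ → ℕ) :
    Contractive (Ty.rename ξ τ) := by
  induction τ generalizing ξ with
  | unit | bool => trivial
  | arr a b iha ihb | prod a b iha ihb | sum a b iha ihb =>
    exact ⟨h.1.imp (·.rename ξ) (iha · ξ), h.2.imp (·.rename ξ) (ihb · ξ)⟩
  | mu a ih => exact ih h _
  | var n => exact h.elim

theorem Contractive.subst {τ : Ty} (h : Contractive τ) {s : ℕ → Ty}
    (hs : ∀ n, IsVar (s n) ∨ Contractive (s n)) : Contractive (Ty.subst s τ) := by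
  have var_case : ∀ {a : Ty} {s : ℕ → Ty}, (∀ n, IsVar (s n) ∨ Contractive (s n)) → IsVar a →
      IsVar (Ty.subst s a) ∨ Contractive (Ty.subst s a) := by
    rintro _ s hs ⟨n, rfl⟩
    exact hs n
  induction τ generalizing s with
  | unit | bool => trivial
  | arr a b iha ihb | prod a b iha ihb | sum a b iha ihb =>
    exact ⟨h.1.elim (var_case hs) fun h => .inr (iha h hs),
      h.2.elim (var_case hs) fun h => .inr (ihb h hs)⟩
  | mu a ih =>
    refine ih (s := liftSub s) h fun n => ?_
    cases n with
    | zero => exact .inl ⟨0, rfl⟩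
    | succ n => exact (hs n).imp (·.rename _) (·.rename _)
  | var n => exact h.elim

/-- The grammar allows a bare variable directly below `→`, `×` and `⊎`, and closedness excludes it.
Hence validity passes to components, on which every descent into a valid type relies. -/
theorem ClosedAt.contractive {τ : Ty} (hc : ClosedAt 0 τ) (h : IsVar τ ∨ Contractive τ) :
    Contractive τ := by
  rcases h with ⟨n, rfl⟩ | h
  · exact absurd hc (Nat.not_lt_zero n)
  · exact h

theorem valid_arr {a b : Ty} : Valid (arr a b) ↔ Valid a ∧ Valid b :=
  ⟨fun h => ⟨⟨h.1.1, h.1.1.contractive h.2.1⟩, ⟨h.1.2, h.1.2.contractive h.2.2⟩⟩,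
    fun h => ⟨⟨h.1.1, h.2.1⟩, ⟨.inr h.1.2, .inr h.2.2⟩⟩⟩

theorem valid_prod {a b : Ty} : Valid (prod a b) ↔ Valid a ∧ Valid b := valid_arr

theorem valid_sum {a b : Ty} : Valid (sum a b) ↔ Valid a ∧ Valid b := valid_arr

theorem valid_unit : Valid unit := ⟨trivial, trivial⟩

theorem valid_bool : Valid bool := ⟨trivial, trivial⟩

theorem Valid.unfoldMu {τ : Ty} (h : Valid (mu τ)) : Valid (unfoldMu τ) := by
  refine ⟨ClosedAt.subst (j := 1) h.1 fun n hn => ?_, Contractive.subst (τ := τ) h.2 fun n => ?_⟩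
  · obtain rfl : n = 0 := by omega
    exact h.1
  · cases n with
    | zero => exact .inr h.2
    | succ n => exact .inl ⟨n, rfl⟩

/-! ## Leading recursive binders -/

/-- The number of leading `μ`s. -/
def leadingMus : Ty → ℕ
  | mu a => leadingMus a + 1
  | _ => 0

/-- Below the leading `μ`s of a contractive type stands a constructor, never a variable, so a
substitution cannot create further leading `μ`s. Unrolling a valid `μ`-type therefore removes one of
them, which makes repeated unrolling stop. -/
theorem Contractive.leadingMus_subst {τ : Ty} (h : Contractive τ) (s : ℕ → Ty) :
    leadingMus (Ty.subst s τ) = leadingMus τ := by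
  induction τ generalizing s with
  | mu a ih => simp only [Ty.subst, leadingMus, ih h]
  | var n => exact h.elim
  | _ => rfl

theorem Valid.leadingMus_unfoldMu {τ : Ty} (h : Valid (mu τ)) :
    leadingMus τ.unfoldMu < leadingMus (mu τ) := by
  simp only [Ty.unfoldMu, Contractive.leadingMus_subst (τ := τ) h.2, leadingMus, Nat.lt_succ_self]

/-- `UnrollsTo τ w`: unrolling the leading `μ`s of `τ` ends in `w`. -/
inductive UnrollsTo : Ty → Ty → Prop
  | refl {w : Ty} : ¬ IsMu w → UnrollsTo w w
  | mu {τ w : Ty} : UnrollsTo (unfoldMu τ) w → UnrollsTo (mu τ) w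

theorem Valid.exists_unrollsTo {τ : Ty} (h : Valid τ) : ∃ w, UnrollsTo τ w := by
  induction hn : leadingMus τ using Nat.strong_induction_on generalizing τ with
  | _ n ih =>
    by_cases hm : IsMu τ
    · obtain ⟨σ, rfl⟩ := hm
      obtain ⟨w, hw⟩ := ih _ (hn ▸ h.leadingMus_unfoldMu) h.unfoldMu rfl
      exact ⟨w, .mu hw⟩
    · exact ⟨τ, .refl hm⟩

theorem UnrollsTo.valid {τ w : Ty} (h : UnrollsTo τ w) (hτ : Valid τ) : Valid w := by
  induction h with
  | refl => exact hτ
  | mu _ ih => exact ih hτ.unfoldMu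

theorem UnrollsTo.of_mu {τ w : Ty} (h : UnrollsTo (Ty.mu τ) w) : UnrollsTo (unfoldMu τ) w := by
  cases h with
  | refl h => exact absurd ⟨τ, rfl⟩ h
  | mu h => exact h

theorem UnrollsTo.eq_of_not_isMu {τ w : Ty} (h : UnrollsTo τ w) (hτ : ¬ IsMu τ) : τ = w := by
  cases h with
  | refl => rfl
  | mu => exact absurd ⟨_, rfl⟩ hτ

/-- Types that unroll to the same type are equal. -/
theorem UnrollsTo.equal {τ σ w : Ty} (hτ : UnrollsTo τ w) (hσ : UnrollsTo σ w) (hv : Valid τ) :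
    Equal τ σ := by
  -- The identity relation is not closed backwards under the rules: `muL` unrolls only the left side
  -- of a pair of identical `μ`-types. The candidate must relate types at different stages of
  -- unrolling, and a common end of unrolling does this.
  refine ⟨fun a b => ∃ w, Valid w ∧ UnrollsTo a w ∧ UnrollsTo b w, ?_, w, hτ.valid hv, hτ, hσ⟩
  rintro a b ⟨w, hw, ha, hb⟩
  have diag : ∀ {c : Ty}, Valid c → ∃ w, Valid w ∧ UnrollsTo c w ∧ UnrollsTo c w := fun hc =>
    let ⟨w, h⟩ := hc.exists_unrollsTo
    ⟨w, h.valid hc, h, h⟩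
  cases ha with
  | mu ha => exact .muL ⟨w, hw, ha, hb⟩
  | refl hm =>
    by_cases hbm : IsMu b
    · obtain ⟨b, rfl⟩ := hbm
      exact .muR hm ⟨a, hw, .refl hm, hb.of_mu⟩
    · obtain rfl := hb.eq_of_not_isMu hbm
      cases b with
      | unit => exact .unit
      | bool => exact .bool
      | arr a b => exact .arr (diag (valid_arr.1 hw).1) (diag (valid_arr.1 hw).2)
      | prod a b => exact .prod (diag (valid_arr.1 hw).1) (diag (valid_arr.1 hw).2)
      | sum a b => exact .sum (diag (valid_arr.1 hw).1) (diag (valid_arr.1 hw).2)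
      | mu a => exact absurd ⟨a, rfl⟩ hm
      | var n => exact .var n

theorem Valid.equal_unfoldMu {τ : Ty} (h : Valid (mu τ)) : Equal (mu τ) (Ty.unfoldMu τ) :=
  let ⟨_, hw⟩ := h.unfoldMu.exists_unrollsTo
  UnrollsTo.equal (.mu hw) hw h

theorem Valid.unfoldMu_equal {τ : Ty} (h : Valid (mu τ)) : Equal (Ty.unfoldMu τ) (mu τ) :=
  let ⟨_, hw⟩ := h.unfoldMu.exists_unrollsTo
  UnrollsTo.equal hw (.mu hw) h.unfoldMu

end Ty

/-- All types in the environment are valid. -/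
def TyEnv.Valid (Γ : TyEnv) : Prop := ∀ τ ∈ Γ, Ty.Valid τ

theorem TyEnv.Valid.cons {Γ : TyEnv} {τ : Ty} (hτ : τ.Valid) (h : TyEnv.Valid Γ) :
    TyEnv.Valid (τ :: Γ) := by
  intro σ hσ
  rcases List.mem_cons.1 hσ with rfl | hσ
  · exact hτ
  · exact h σ hσ

theorem TyEnv.valid_nil : TyEnv.Valid [] := fun _ h => absurd h (List.not_mem_nil)

namespace Iso

namespace Tm

/-! ## Renaming and substitution -/

theorem rename_rename (ξ ζ : ℕ → ℕ) (t : Tm) :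
    rename ζ (rename ξ t) = rename (fun n => ζ (ξ n)) t := by
  have lift : ∀ ξ ζ : ℕ → ℕ, (fun n => liftRen ζ (liftRen ξ n)) = liftRen fun n => ζ (ξ n) := by
    intro ξ ζ
    funext n
    cases n <;> rfl
  induction t generalizing ξ ζ <;> simp_all only [rename]

theorem rename_succ_rename (ξ : ℕ → ℕ) (t : Tm) :
    rename (liftRen ξ) (rename Nat.succ t) = rename Nat.succ (rename ξ t) := by
  rw [rename_rename, rename_rename]
  rfl

theorem subst_rename (ξ : ℕ → ℕ) (s : ℕ → Tm) (t : Tm) :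
    subst s (rename ξ t) = subst (fun n => s (ξ n)) t := by
  have lift : ∀ (ξ : ℕ → ℕ) (s : ℕ → Tm),
      (fun n => liftSub s (liftRen ξ n)) = liftSub fun n => s (ξ n) := by
    intro ξ s
    funext n
    cases n <;> rfl
  induction t generalizing ξ s <;> simp_all only [rename, subst]

theorem rename_subst (ξ : ℕ → ℕ) (s : ℕ → Tm) (t : Tm) :
    rename ξ (subst s t) = subst (fun n => rename ξ (s n)) t := by
  have lift : ∀ (ξ : ℕ → ℕ) (s : ℕ → Tm),
      (fun n => rename (liftRen ξ) (liftSub s n)) = liftSub fun n => rename ξ (s n) := by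
    intro ξ s
    funext n
    cases n with
    | zero => rfl
    | succ n => exact rename_succ_rename ξ (s n)
  induction t generalizing ξ s <;> simp_all only [rename, subst]

theorem subst_liftSub_rename_succ (s : ℕ → Tm) (t : Tm) :
    subst (liftSub s) (rename Nat.succ t) = rename Nat.succ (subst s t) := by
  rw [subst_rename, rename_subst]
  rfl

theorem subst_var (t : Tm) : subst var t = t := by
  have lift : liftSub var = var := by
    funext n
    cases n <;> rfl
  induction t <;> simp_all only [subst]

theorem inst_rename_succ (t v : Tm) : (rename Nat.succ t).inst v = t := by
  rw [inst, subst_rename]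
  exact subst_var t

end Tm

theorem IsValue.rename {v : Tm} (h : IsValue v) (ξ : ℕ → ℕ) : IsValue (v.rename ξ) := by
  induction h with
  | unit => exact .unit
  | true => exact .true
  | false => exact .false
  | lam => exact .lam _ _
  | pair _ _ ih₁ ih₂ => exact .pair ih₁ ih₂
  | inl _ ih => exact .inl ih
  | inr _ ih => exact .inr ih
  | fold _ ih => exact .fold ih

theorem IsValue.subst {v : Tm} (h : IsValue v) (s : ℕ → Tm) : IsValue (v.subst s) := by
  induction h with
  | unit => exact .unit
  | true => exact .true
  | false => exact .false
  | lam => exact .lam _ _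
  | pair _ _ ih₁ ih₂ => exact .pair ih₁ ih₂
  | inl _ ih => exact .inl ih
  | inr _ ih => exact .inr ih
  | fold _ ih => exact .fold ih

/-! ## Typing -/

theorem HasType.rename {Γ Δ : TyEnv} {t : Tm} {τ : Ty} {ξ : ℕ → ℕ} (h : HasType Γ t τ)
    (hξ : ∀ n σ, Γ[n]? = some σ → Δ[ξ n]? = some σ) : HasType Δ (t.rename ξ) τ := by
  have lift : ∀ {Γ Δ : TyEnv} {ξ : ℕ → ℕ} {τ : Ty},
      (∀ n σ, Γ[n]? = some σ → Δ[ξ n]? = some σ) →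
      ∀ n σ, (τ :: Γ)[n]? = some σ → (τ :: Δ)[liftRen ξ n]? = some σ := by
    intro Γ Δ ξ τ hξ n σ hn
    cases n with
    | zero => exact hn
    | succ n => exact hξ n σ hn
  induction h generalizing Δ ξ with
  | var h => exact .var (hξ _ _ h)
  | unit => exact .unit
  | true => exact .true
  | false => exact .false
  | lam hv _ ih => exact .lam hv (ih (lift hξ))
  | app _ _ ih₁ ih₂ => exact .app (ih₁ hξ) (ih₂ hξ)
  | fst _ ih => exact .fst (ih hξ)
  | snd _ ih => exact .snd (ih hξ)
  | pair _ _ ih₁ ih₂ => exact .pair (ih₁ hξ) (ih₂ hξ)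
  | inl hv _ ih => exact .inl hv (ih hξ)
  | inr hv _ ih => exact .inr hv (ih hξ)
  | case _ _ _ ih₁ ih₂ ih₃ => exact .case (ih₁ hξ) (ih₂ (lift hξ)) (ih₃ (lift hξ))
  | ite _ _ _ ih₁ ih₂ ih₃ => exact .ite (ih₁ hξ) (ih₂ hξ) (ih₃ hξ)
  | seq _ _ ih₁ ih₂ => exact .seq (ih₁ hξ) (ih₂ hξ)
  | fold hv _ ih => exact .fold hv (ih hξ)
  | unfold hv _ ih => exact .unfold hv (ih hξ)

theorem HasType.subst {Γ Δ : TyEnv} {t : Tm} {τ : Ty} {s : ℕ → Tm} (h : HasType Γ t τ)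
    (hs : ∀ n σ, Γ[n]? = some σ → HasType Δ (s n) σ) : HasType Δ (t.subst s) τ := by
  have lift : ∀ {Γ Δ : TyEnv} {s : ℕ → Tm} {τ : Ty},
      (∀ n σ, Γ[n]? = some σ → HasType Δ (s n) σ) →
      ∀ n σ, (τ :: Γ)[n]? = some σ → HasType (τ :: Δ) (Tm.liftSub s n) σ := by
    intro Γ Δ s τ hs n σ hn
    cases n with
    | zero => exact .var hn
    | succ n => exact (hs n σ hn).rename fun _ _ h => h
  induction h generalizing Δ s with
  | var h => exact hs _ _ h
  | unit => exact .unit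
  | true => exact .true
  | false => exact .false
  | lam hv _ ih => exact .lam hv (ih (lift hs))
  | app _ _ ih₁ ih₂ => exact .app (ih₁ hs) (ih₂ hs)
  | fst _ ih => exact .fst (ih hs)
  | snd _ ih => exact .snd (ih hs)
  | pair _ _ ih₁ ih₂ => exact .pair (ih₁ hs) (ih₂ hs)
  | inl hv _ ih => exact .inl hv (ih hs)
  | inr hv _ ih => exact .inr hv (ih hs)
  | case _ _ _ ih₁ ih₂ ih₃ => exact .case (ih₁ hs) (ih₂ (lift hs)) (ih₃ (lift hs))
  | ite _ _ _ ih₁ ih₂ ih₃ => exact .ite (ih₁ hs) (ih₂ hs) (ih₃ hs)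
  | seq _ _ ih₁ ih₂ => exact .seq (ih₁ hs) (ih₂ hs)
  | fold hv _ ih => exact .fold hv (ih hs)
  | unfold hv _ ih => exact .unfold hv (ih hs)

theorem HasType.inst {t v : Tm} {τ σ : Ty} (ht : HasType [σ] t τ) (hv : HasType [] v σ) :
    HasType [] (t.inst v) τ := by
  refine ht.subst fun n ρ hn => ?_
  cases n with
  | zero =>
    obtain rfl : σ = ρ := by simpa using hn
    exact hv
  | succ n => simp at hn

theorem HasType.valid {Γ : TyEnv} {t : Tm} {τ : Ty} (h : HasType Γ t τ) (hΓ : TyEnv.Valid Γ) :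
    τ.Valid := by
  induction h with
  | var h => exact hΓ _ (List.mem_of_getElem? h)
  | unit => exact Ty.valid_unit
  | true | false => exact Ty.valid_bool
  | lam hv _ ih => exact Ty.valid_arr.2 ⟨hv, ih (.cons hv hΓ)⟩
  | app _ _ ih₁ _ => exact (Ty.valid_arr.1 (ih₁ hΓ)).2
  | fst _ ih => exact (Ty.valid_prod.1 (ih hΓ)).1
  | snd _ ih => exact (Ty.valid_prod.1 (ih hΓ)).2
  | pair _ _ ih₁ ih₂ => exact Ty.valid_prod.2 ⟨ih₁ hΓ, ih₂ hΓ⟩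
  | inl hv _ ih => exact Ty.valid_sum.2 ⟨ih hΓ, hv⟩
  | inr hv _ ih => exact Ty.valid_sum.2 ⟨hv, ih hΓ⟩
  | case _ _ _ ih₁ ih₂ _ => exact ih₂ (.cons (Ty.valid_sum.1 (ih₁ hΓ)).1 hΓ)
  | ite _ _ _ _ ih₂ _ => exact ih₂ hΓ
  | seq _ _ _ ih₂ => exact ih₂ hΓ
  | fold hv _ _ => exact hv
  | unfold hv _ _ => exact hv.unfoldMu

theorem CtxType.fill {Γ₀ Γ : TyEnv} {τ₀ τ : Ty} {C : Ctx} {t : Tm} (h : CtxType Γ₀ τ₀ C Γ τ)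
    (ht : HasType Γ₀ t τ₀) : HasType Γ (C.fill t) τ := by
  induction h with
  | hole => exact ht
  | lam hv _ ih => exact .lam hv ih
  | app₁ _ h ih => exact .app ih h
  | app₂ h _ ih => exact .app h ih
  | fst _ ih => exact .fst ih
  | snd _ ih => exact .snd ih
  | pair₁ _ h ih => exact .pair ih h
  | pair₂ h _ ih => exact .pair h ih
  | case₁ _ h₁ h₂ ih => exact .case ih h₁ h₂
  | case₂ h₁ _ h₂ ih => exact .case h₁ ih h₂
  | case₃ h₁ h₂ _ ih => exact .case h₁ h₂ ih
  | inl hv _ ih => exact .inl hv ih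
  | inr hv _ ih => exact .inr hv ih
  | seq₁ _ h ih => exact .seq ih h
  | seq₂ h _ ih => exact .seq h ih
  | ite₁ _ h₁ h₂ ih => exact .ite ih h₁ h₂
  | ite₂ h₁ _ h₂ ih => exact .ite h₁ ih h₂
  | ite₃ h₁ h₂ _ ih => exact .ite h₁ h₂ ih
  | fold hv _ ih => exact .fold hv ih
  | unfold hv _ ih => exact .unfold hv ih

end Iso

/-! ### Validity of the types in equi-recursive derivations -/

namespace Equi

/-- The equality rule requires validity of the new type only. The back-translation also needs
validity of the old type, in order to build and type a coercion between the two. -/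
theorem HasType.valid {Γ : TyEnv} {t : Tm} {τ : Ty} (h : HasType Γ t τ) (hΓ : TyEnv.Valid Γ) :
    τ.Valid := by
  induction h with
  | var h => exact hΓ _ (List.mem_of_getElem? h)
  | unit => exact Ty.valid_unit
  | true | false => exact Ty.valid_bool
  | lam hv _ ih => exact Ty.valid_arr.2 ⟨hv, ih (.cons hv hΓ)⟩
  | app _ _ ih₁ _ => exact (Ty.valid_arr.1 (ih₁ hΓ)).2
  | fst _ ih => exact (Ty.valid_prod.1 (ih hΓ)).1
  | snd _ ih => exact (Ty.valid_prod.1 (ih hΓ)).2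
  | pair _ _ ih₁ ih₂ => exact Ty.valid_prod.2 ⟨ih₁ hΓ, ih₂ hΓ⟩
  | inl hv _ ih => exact Ty.valid_sum.2 ⟨ih hΓ, hv⟩
  | inr hv _ ih => exact Ty.valid_sum.2 ⟨hv, ih hΓ⟩
  | case _ _ _ ih₁ ih₂ _ => exact ih₂ (.cons (Ty.valid_sum.1 (ih₁ hΓ)).1 hΓ)
  | ite _ _ _ _ ih₂ _ => exact ih₂ hΓ
  | seq _ _ _ ih₂ => exact ih₂ hΓ
  | eq hv _ _ _ => exact hv

theorem CtxType.valid {Γ₀ Γ : TyEnv} {τ₀ τ : Ty} {C : Ctx} (h : CtxType Γ₀ τ₀ C Γ τ)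
    (hτ₀ : τ₀.Valid) (hΓ : TyEnv.Valid Γ) : τ.Valid := by
  induction h with
  | hole => exact hτ₀
  | lam hv _ ih => exact Ty.valid_arr.2 ⟨hv, ih (.cons hv hΓ)⟩
  | app₁ _ _ ih => exact (Ty.valid_arr.1 (ih hΓ)).2
  | app₂ h _ _ => exact (Ty.valid_arr.1 (h.valid hΓ)).2
  | fst _ ih => exact (Ty.valid_prod.1 (ih hΓ)).1
  | snd _ ih => exact (Ty.valid_prod.1 (ih hΓ)).2
  | pair₁ _ h ih => exact Ty.valid_prod.2 ⟨ih hΓ, h.valid hΓ⟩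
  | pair₂ h _ ih => exact Ty.valid_prod.2 ⟨h.valid hΓ, ih hΓ⟩
  | case₁ _ h _ ih => exact h.valid (.cons (Ty.valid_sum.1 (ih hΓ)).1 hΓ)
  | case₂ h _ _ ih => exact ih (.cons (Ty.valid_sum.1 (h.valid hΓ)).1 hΓ)
  | case₃ h _ _ ih => exact ih (.cons (Ty.valid_sum.1 (h.valid hΓ)).2 hΓ)
  | inl hv _ ih => exact Ty.valid_sum.2 ⟨ih hΓ, hv⟩
  | inr hv _ ih => exact Ty.valid_sum.2 ⟨hv, ih hΓ⟩
  | seq₁ _ h _ => exact h.valid hΓ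
  | seq₂ _ _ ih => exact ih hΓ
  | ite₁ _ h _ _ => exact h.valid hΓ
  | ite₂ _ _ _ ih => exact ih hΓ
  | ite₃ _ _ _ ih => exact ih hΓ
  | eq hv _ _ _ => exact hv

end Equi

namespace Iso

/-! ## Big-step semantics -/

/-- `BigStep n t v`: the term `t` evaluates to `v` by a derivation of size `n`. -/
inductive BigStep : ℕ → Tm → Tm → Prop
  | unit : BigStep 0 .unit .unit
  | true : BigStep 0 .true .true
  | false : BigStep 0 .false .false
  | lam {τ : Ty} {t : Tm} : BigStep 0 (.lam τ t) (.lam τ t)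
  | app {n₁ n₂ n₃ : ℕ} {τ : Ty} {t u b w v : Tm} :
      BigStep n₁ t (.lam τ b) → BigStep n₂ u w → BigStep n₃ (b.inst w) v →
      BigStep (n₁ + n₂ + n₃ + 1) (.app t u) v
  | fst {n : ℕ} {t v w : Tm} : BigStep n t (.pair v w) → BigStep (n + 1) (.fst t) v
  | snd {n : ℕ} {t v w : Tm} : BigStep n t (.pair v w) → BigStep (n + 1) (.snd t) w
  | pair {n₁ n₂ : ℕ} {t u v w : Tm} :
      BigStep n₁ t v → BigStep n₂ u w → BigStep (n₁ + n₂ + 1) (.pair t u) (.pair v w)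
  | inl {n : ℕ} {t v : Tm} : BigStep n t v → BigStep (n + 1) (.inl t) (.inl v)
  | inr {n : ℕ} {t v : Tm} : BigStep n t v → BigStep (n + 1) (.inr t) (.inr v)
  | caseInl {n₁ n₂ : ℕ} {t u₁ u₂ w v : Tm} :
      BigStep n₁ t (.inl w) → BigStep n₂ (u₁.inst w) v → BigStep (n₁ + n₂ + 1) (.case t u₁ u₂) v
  | caseInr {n₁ n₂ : ℕ} {t u₁ u₂ w v : Tm} :
      BigStep n₁ t (.inr w) → BigStep n₂ (u₂.inst w) v → BigStep (n₁ + n₂ + 1) (.case t u₁ u₂) v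
  | iteTrue {n₁ n₂ : ℕ} {t u₁ u₂ v : Tm} :
      BigStep n₁ t .true → BigStep n₂ u₁ v → BigStep (n₁ + n₂ + 1) (.ite t u₁ u₂) v
  | iteFalse {n₁ n₂ : ℕ} {t u₁ u₂ v : Tm} :
      BigStep n₁ t .false → BigStep n₂ u₂ v → BigStep (n₁ + n₂ + 1) (.ite t u₁ u₂) v
  | seq {n₁ n₂ : ℕ} {t u v : Tm} :
      BigStep n₁ t .unit → BigStep n₂ u v → BigStep (n₁ + n₂ + 1) (.seq t u) v
  | fold {n : ℕ} {τ : Ty} {t v : Tm} : BigStep n t v → BigStep (n + 1) (.fold τ t) (.fold τ v)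
  | unfold {n : ℕ} {τ : Ty} {t v : Tm} :
      BigStep n t (.fold τ v) → BigStep (n + 1) (.unfold τ t) v

theorem BigStep.isValue {n : ℕ} {t v : Tm} (h : BigStep n t v) : IsValue v := by
  induction h with
  | unit => exact .unit
  | true => exact .true
  | false => exact .false
  | lam => exact .lam _ _
  | app _ _ _ _ _ ih => exact ih
  | fst _ ih => cases ih; assumption
  | snd _ ih => cases ih; assumption
  | pair _ _ ih₁ ih₂ => exact .pair ih₁ ih₂
  | inl _ ih => exact .inl ih
  | inr _ ih => exact .inr ih
  | caseInl _ _ _ ih | caseInr _ _ _ ih | iteTrue _ _ _ ih | iteFalse _ _ _ ih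
  | seq _ _ _ ih => exact ih
  | fold _ ih => exact .fold ih
  | unfold _ ih => cases ih; assumption

theorem BigStep.eq_of_isValue {n : ℕ} {v w : Tm} (h : BigStep n v w) (hv : IsValue v) :
    v = w := by
  induction hv generalizing n w with
  | unit | true | false | lam => cases h; rfl
  | pair _ _ ih₁ ih₂ => cases h with | pair h₁ h₂ => rw [ih₁ h₁, ih₂ h₂]
  | inl _ ih => cases h with | inl h => rw [ih h]
  | inr _ ih => cases h with | inr h => rw [ih h]
  | fold _ ih => cases h with | fold h => rw [ih h]

/-- `t` evaluates to `v`. -/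
def Eval (t v : Tm) : Prop := ∃ n, BigStep n t v

namespace Eval

theorem isValue {t v : Tm} : Eval t v → IsValue v := fun ⟨_, h⟩ => h.isValue

theorem unit : Eval .unit .unit := ⟨_, .unit⟩

theorem true : Eval .true .true := ⟨_, .true⟩

theorem false : Eval .false .false := ⟨_, .false⟩

theorem lam {τ : Ty} {t : Tm} : Eval (.lam τ t) (.lam τ t) := ⟨_, .lam⟩

theorem app {τ : Ty} {t u b w v : Tm} :
    Eval t (.lam τ b) → Eval u w → Eval (b.inst w) v → Eval (.app t u) v :=
  fun ⟨_, h₁⟩ ⟨_, h₂⟩ ⟨_, h₃⟩ => ⟨_, .app h₁ h₂ h₃⟩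

theorem fst {t v w : Tm} : Eval t (.pair v w) → Eval (.fst t) v := fun ⟨_, h⟩ => ⟨_, .fst h⟩

theorem snd {t v w : Tm} : Eval t (.pair v w) → Eval (.snd t) w := fun ⟨_, h⟩ => ⟨_, .snd h⟩

theorem pair {t u v w : Tm} : Eval t v → Eval u w → Eval (.pair t u) (.pair v w) :=
  fun ⟨_, h₁⟩ ⟨_, h₂⟩ => ⟨_, .pair h₁ h₂⟩

theorem inl {t v : Tm} : Eval t v → Eval (.inl t) (.inl v) := fun ⟨_, h⟩ => ⟨_, .inl h⟩

theorem inr {t v : Tm} : Eval t v → Eval (.inr t) (.inr v) := fun ⟨_, h⟩ => ⟨_, .inr h⟩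

theorem caseInl {t u₁ u₂ w v : Tm} :
    Eval t (.inl w) → Eval (u₁.inst w) v → Eval (.case t u₁ u₂) v :=
  fun ⟨_, h₁⟩ ⟨_, h₂⟩ => ⟨_, .caseInl h₁ h₂⟩

theorem caseInr {t u₁ u₂ w v : Tm} :
    Eval t (.inr w) → Eval (u₂.inst w) v → Eval (.case t u₁ u₂) v :=
  fun ⟨_, h₁⟩ ⟨_, h₂⟩ => ⟨_, .caseInr h₁ h₂⟩

theorem iteTrue {t u₁ u₂ v : Tm} : Eval t .true → Eval u₁ v → Eval (.ite t u₁ u₂) v :=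
  fun ⟨_, h₁⟩ ⟨_, h₂⟩ => ⟨_, .iteTrue h₁ h₂⟩

theorem iteFalse {t u₁ u₂ v : Tm} : Eval t .false → Eval u₂ v → Eval (.ite t u₁ u₂) v :=
  fun ⟨_, h₁⟩ ⟨_, h₂⟩ => ⟨_, .iteFalse h₁ h₂⟩

theorem seq {t u v : Tm} : Eval t .unit → Eval u v → Eval (.seq t u) v :=
  fun ⟨_, h₁⟩ ⟨_, h₂⟩ => ⟨_, .seq h₁ h₂⟩

theorem fold {τ : Ty} {t v : Tm} : Eval t v → Eval (.fold τ t) (.fold τ v) :=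
  fun ⟨_, h⟩ => ⟨_, .fold h⟩

theorem unfold {τ : Ty} {t v : Tm} : Eval t (.fold τ v) → Eval (.unfold τ t) v :=
  fun ⟨_, h⟩ => ⟨_, .unfold h⟩

end Eval

theorem IsValue.eval {v : Tm} (h : IsValue v) : Eval v v := by
  induction h with
  | unit => exact .unit
  | true => exact .true
  | false => exact .false
  | lam => exact .lam
  | pair _ _ ih₁ ih₂ => exact .pair ih₁ ih₂
  | inl _ ih => exact .inl ih
  | inr _ ih => exact .inr ih
  | fold _ ih => exact .fold ih

theorem PrimStep.eval {t t' v : Tm} (h : PrimStep t t') (hv : Eval t' v) : Eval t v := by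
  cases h with
  | beta hw => exact .app .lam hw.eval hv
  | fst h₁ h₂ =>
    obtain rfl := hv.choose_spec.eq_of_isValue h₁
    exact .fst (.pair h₁.eval h₂.eval)
  | snd h₁ h₂ =>
    obtain rfl := hv.choose_spec.eq_of_isValue h₂
    exact .snd (.pair h₁.eval h₂.eval)
  | seq => exact .seq .unit hv
  | inl hw => exact .caseInl (.inl hw.eval) hv
  | inr hw => exact .caseInr (.inr hw.eval) hv
  | iteTrue => exact .iteTrue .true hv
  | iteFalse => exact .iteFalse .false hv
  | unfoldFold h =>
    obtain rfl := hv.choose_spec.eq_of_isValue h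
    exact .unfold (.fold h.eval)

theorem Step.eval {t t' v : Tm} (h : Step t t') (hv : Eval t' v) : Eval t v := by
  obtain ⟨hE, hp⟩ := h
  induction hE generalizing v with
  | hole => exact hp.eval hv
  | app₁ _ ih =>
    obtain ⟨_, hv⟩ := hv
    cases hv with | app h₁ h₂ h₃ => exact .app (ih ⟨_, h₁⟩) ⟨_, h₂⟩ ⟨_, h₃⟩
  | app₂ _ _ ih =>
    obtain ⟨_, hv⟩ := hv
    cases hv with | app h₁ h₂ h₃ => exact .app ⟨_, h₁⟩ (ih ⟨_, h₂⟩) ⟨_, h₃⟩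
  | fst _ ih =>
    obtain ⟨_, hv⟩ := hv
    cases hv with | fst h => exact .fst (ih ⟨_, h⟩)
  | snd _ ih =>
    obtain ⟨_, hv⟩ := hv
    cases hv with | snd h => exact .snd (ih ⟨_, h⟩)
  | pair₁ _ ih =>
    obtain ⟨_, hv⟩ := hv
    cases hv with | pair h₁ h₂ => exact .pair (ih ⟨_, h₁⟩) ⟨_, h₂⟩
  | pair₂ _ _ ih =>
    obtain ⟨_, hv⟩ := hv
    cases hv with | pair h₁ h₂ => exact .pair ⟨_, h₁⟩ (ih ⟨_, h₂⟩)
  | case₁ _ ih =>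
    obtain ⟨_, hv⟩ := hv
    cases hv with
    | caseInl h₁ h₂ => exact .caseInl (ih ⟨_, h₁⟩) ⟨_, h₂⟩
    | caseInr h₁ h₂ => exact .caseInr (ih ⟨_, h₁⟩) ⟨_, h₂⟩
  | inl _ ih =>
    obtain ⟨_, hv⟩ := hv
    cases hv with | inl h => exact .inl (ih ⟨_, h⟩)
  | inr _ ih =>
    obtain ⟨_, hv⟩ := hv
    cases hv with | inr h => exact .inr (ih ⟨_, h⟩)
  | seq₁ _ ih =>
    obtain ⟨_, hv⟩ := hv
    cases hv with | seq h₁ h₂ => exact .seq (ih ⟨_, h₁⟩) ⟨_, h₂⟩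
  | ite₁ _ ih =>
    obtain ⟨_, hv⟩ := hv
    cases hv with
    | iteTrue h₁ h₂ => exact .iteTrue (ih ⟨_, h₁⟩) ⟨_, h₂⟩
    | iteFalse h₁ h₂ => exact .iteFalse (ih ⟨_, h₁⟩) ⟨_, h₂⟩
  | fold _ ih =>
    obtain ⟨_, hv⟩ := hv
    cases hv with | fold h => exact .fold (ih ⟨_, h⟩)
  | unfold _ ih =>
    obtain ⟨_, hv⟩ := hv
    cases hv with | unfold h => exact .unfold (ih ⟨_, h⟩)

open Relation (ReflTransGen)

theorem PrimStep.step {t t' : Tm} (h : PrimStep t t') : Step t t' := .ctx (E := .hole) .hole h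

/-- Reduction of the subterm in a frame. -/
theorem Step.frame (F : Ctx → Ctx) (f : Tm → Tm) (hF : ∀ E, E.IsEval → (F E).IsEval)
    (hf : ∀ E t, (F E).fill t = f (E.fill t)) {t t' : Tm} (h : ReflTransGen Step t t') :
    ReflTransGen Step (f t) (f t') := by
  refine h.lift f ?_
  rintro _ _ ⟨hE, hp⟩
  change Step (f _) (f _)
  rw [← hf, ← hf]
  exact .ctx (hF _ hE) hp

theorem Eval.steps {t v : Tm} (h : Eval t v) : ReflTransGen Step t v := by
  obtain ⟨n, h⟩ := h
  induction h with
  | unit | true | false | lam => exact .refl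
  | @app _ _ _ τ t u b w v h₁ h₂ h₃ ih₁ ih₂ ih₃ =>
    have h₁' := Step.frame (.app₁ · u) (.app · u) (fun _ h => .app₁ h) (fun _ _ => rfl) ih₁
    have h₂' := Step.frame (.app₂ (.lam τ b)) (.app (.lam τ b)) (fun _ h => .app₂ (.lam _ _) h)
      (fun _ _ => rfl) ih₂
    exact ((h₁'.trans h₂').tail (PrimStep.beta h₂.isValue).step).trans ih₃
  | fst h ih =>
    cases h.isValue
    exact (Step.frame .fst .fst (fun _ h => .fst h) (fun _ _ => rfl) ih).tail
      (PrimStep.fst ‹_› ‹_›).step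
  | snd h ih =>
    cases h.isValue
    exact (Step.frame .snd .snd (fun _ h => .snd h) (fun _ _ => rfl) ih).tail
      (PrimStep.snd ‹_› ‹_›).step
  | @pair _ _ t u v w h₁ h₂ ih₁ ih₂ =>
    have h₁' := Step.frame (.pair₁ · u) (.pair · u) (fun _ h => .pair₁ h) (fun _ _ => rfl) ih₁
    exact h₁'.trans (Step.frame (.pair₂ v) (.pair v) (fun _ h => .pair₂ h₁.isValue h)
      (fun _ _ => rfl) ih₂)
  | inl h ih => exact Step.frame .inl .inl (fun _ h => .inl h) (fun _ _ => rfl) ih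
  | inr h ih => exact Step.frame .inr .inr (fun _ h => .inr h) (fun _ _ => rfl) ih
  | @caseInl _ _ t u₁ u₂ w v h₁ h₂ ih₁ ih₂ =>
    cases h₁.isValue
    have h₁' := Step.frame (.case₁ · u₁ u₂) (.case · u₁ u₂) (fun _ h => .case₁ h)
      (fun _ _ => rfl) ih₁
    exact (h₁'.tail (PrimStep.inl ‹_›).step).trans ih₂
  | @caseInr _ _ t u₁ u₂ w v h₁ h₂ ih₁ ih₂ =>
    cases h₁.isValue
    have h₁' := Step.frame (.case₁ · u₁ u₂) (.case · u₁ u₂) (fun _ h => .case₁ h)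
      (fun _ _ => rfl) ih₁
    exact (h₁'.tail (PrimStep.inr ‹_›).step).trans ih₂
  | @iteTrue _ _ t u₁ u₂ v h₁ h₂ ih₁ ih₂ =>
    have h₁' := Step.frame (.ite₁ · u₁ u₂) (.ite · u₁ u₂) (fun _ h => .ite₁ h)
      (fun _ _ => rfl) ih₁
    exact (h₁'.tail PrimStep.iteTrue.step).trans ih₂
  | @iteFalse _ _ t u₁ u₂ v h₁ h₂ ih₁ ih₂ =>
    have h₁' := Step.frame (.ite₁ · u₁ u₂) (.ite · u₁ u₂) (fun _ h => .ite₁ h)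
      (fun _ _ => rfl) ih₁
    exact (h₁'.tail PrimStep.iteFalse.step).trans ih₂
  | @seq _ _ t u v h₁ h₂ ih₁ ih₂ =>
    have h₁' := Step.frame (.seq₁ · u) (.seq · u) (fun _ h => .seq₁ h) (fun _ _ => rfl) ih₁
    exact (h₁'.tail PrimStep.seq.step).trans ih₂
  | fold h ih => exact Step.frame (.fold _) (.fold _) (fun _ h => .fold h) (fun _ _ => rfl) ih
  | unfold h ih =>
    cases h.isValue
    exact (Step.frame (.unfold _) (.unfold _) (fun _ h => .unfold h) (fun _ _ => rfl) ih).tail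
      (PrimStep.unfoldFold ‹_›).step

/-- A reduction step can be prepended to a big-step evaluation, and conversely each big-step rule is
a composition of reductions inside frames. From here on only big-step evaluation is used. -/
theorem terminates_iff_eval {t : Tm} : Terminates t ↔ ∃ v, Eval t v := by
  constructor
  · rintro ⟨n, v, h⟩
    refine ⟨v, ?_⟩
    induction h with
    | value hv => exact hv.eval
    | step hs _ ih => exact hs.eval ih
  · rintro ⟨v, h⟩
    have hv := h.isValue
    have hs := h.steps
    clear h
    induction hs using ReflTransGen.head_induction_on with
    | refl => exact ⟨0, v, .value hv⟩
    | head hs _ ih =>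
      obtain ⟨n, w, hw⟩ := ih
      exact ⟨n + 1, w, .step hs hw⟩

/-! ## Type preservation -/

theorem BigStep.hasType {n : ℕ} {t v : Tm} {τ : Ty} (h : BigStep n t v) (ht : HasType [] t τ) :
    HasType [] v τ := by
  induction h generalizing τ with
  | unit | true | false | lam => exact ht
  | app _ _ _ ih₁ ih₂ ih₃ =>
    cases ht with | app h₁ h₂ =>
    cases ih₁ h₁ with | lam _ hb => exact ih₃ (hb.inst (ih₂ h₂))
  | fst _ ih =>
    cases ht with | fst h =>
    cases ih h with | pair h₁ _ => exact h₁
  | snd _ ih =>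
    cases ht with | snd h =>
    cases ih h with | pair _ h₂ => exact h₂
  | pair _ _ ih₁ ih₂ => cases ht with | pair h₁ h₂ => exact .pair (ih₁ h₁) (ih₂ h₂)
  | inl _ ih => cases ht with | inl hv h => exact .inl hv (ih h)
  | inr _ ih => cases ht with | inr hv h => exact .inr hv (ih h)
  | caseInl _ _ ih₁ ih₂ =>
    cases ht with | case h₁ h₂ _ =>
    cases ih₁ h₁ with | inl _ hw => exact ih₂ (h₂.inst hw)
  | caseInr _ _ ih₁ ih₂ =>
    cases ht with | case h₁ _ h₂ =>
    cases ih₁ h₁ with | inr _ hw => exact ih₂ (h₂.inst hw)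
  | iteTrue _ _ _ ih => cases ht with | ite _ h _ => exact ih h
  | iteFalse _ _ _ ih => cases ht with | ite _ _ h => exact ih h
  | seq _ _ _ ih => cases ht with | seq _ h => exact ih h
  | fold _ ih => cases ht with | fold hv h => exact .fold hv (ih h)
  | unfold _ ih =>
    cases ht with | unfold _ h =>
    cases ih h with | fold _ h => exact h

theorem Eval.hasType {t v : Tm} {τ : Ty} (h : Eval t v) (ht : HasType [] t τ) :
    HasType [] v τ :=
  h.choose_spec.hasType ht

end Iso

namespace Equi

/-! ## Big-step semantics of the equi-recursive calculus -/

/-- `t` evaluates to `v`. -/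
inductive Eval : Tm → Tm → Prop
  | unit : Eval .unit .unit
  | true : Eval .true .true
  | false : Eval .false .false
  | lam {τ : Ty} {t : Tm} : Eval (.lam τ t) (.lam τ t)
  | app {τ : Ty} {t u b w v : Tm} :
      Eval t (.lam τ b) → Eval u w → Eval (b.inst w) v → Eval (.app t u) v
  | fst {t v w : Tm} : Eval t (.pair v w) → Eval (.fst t) v
  | snd {t v w : Tm} : Eval t (.pair v w) → Eval (.snd t) w
  | pair {t u v w : Tm} : Eval t v → Eval u w → Eval (.pair t u) (.pair v w)
  | inl {t v : Tm} : Eval t v → Eval (.inl t) (.inl v)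
  | inr {t v : Tm} : Eval t v → Eval (.inr t) (.inr v)
  | caseInl {t u₁ u₂ w v : Tm} : Eval t (.inl w) → Eval (u₁.inst w) v → Eval (.case t u₁ u₂) v
  | caseInr {t u₁ u₂ w v : Tm} : Eval t (.inr w) → Eval (u₂.inst w) v → Eval (.case t u₁ u₂) v
  | iteTrue {t u₁ u₂ v : Tm} : Eval t .true → Eval u₁ v → Eval (.ite t u₁ u₂) v
  | iteFalse {t u₁ u₂ v : Tm} : Eval t .false → Eval u₂ v → Eval (.ite t u₁ u₂) v
  | seq {t u v : Tm} : Eval t .unit → Eval u v → Eval (.seq t u) v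

theorem Eval.isValue {t v : Tm} (h : Eval t v) : IsValue v := by
  induction h with
  | unit => exact .unit
  | true => exact .true
  | false => exact .false
  | lam => exact .lam _ _
  | app _ _ _ _ _ ih => exact ih
  | fst _ ih => cases ih; assumption
  | snd _ ih => cases ih; assumption
  | pair _ _ ih₁ ih₂ => exact .pair ih₁ ih₂
  | inl _ ih => exact .inl ih
  | inr _ ih => exact .inr ih
  | caseInl _ _ _ ih | caseInr _ _ _ ih | iteTrue _ _ _ ih | iteFalse _ _ _ ih
  | seq _ _ _ ih => exact ih

theorem Eval.eq_of_isValue {v w : Tm} (h : Eval v w) (hv : IsValue v) : v = w := by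
  induction hv generalizing w with
  | unit | true | false | lam => cases h; rfl
  | pair _ _ ih₁ ih₂ => cases h with | pair h₁ h₂ => rw [ih₁ h₁, ih₂ h₂]
  | inl _ ih => cases h with | inl h => rw [ih h]
  | inr _ ih => cases h with | inr h => rw [ih h]

theorem IsValue.eval {v : Tm} (h : IsValue v) : Eval v v := by
  induction h with
  | unit => exact .unit
  | true => exact .true
  | false => exact .false
  | lam => exact .lam
  | pair _ _ ih₁ ih₂ => exact .pair ih₁ ih₂
  | inl _ ih => exact .inl ih
  | inr _ ih => exact .inr ih

theorem PrimStep.eval {t t' v : Tm} (h : PrimStep t t') (hv : Eval t' v) : Eval t v := by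
  cases h with
  | beta hw => exact .app .lam hw.eval hv
  | fst h₁ h₂ =>
    obtain rfl := hv.eq_of_isValue h₁
    exact .fst (.pair h₁.eval h₂.eval)
  | snd h₁ h₂ =>
    obtain rfl := hv.eq_of_isValue h₂
    exact .snd (.pair h₁.eval h₂.eval)
  | seq => exact .seq .unit hv
  | inl hw => exact .caseInl (.inl hw.eval) hv
  | inr hw => exact .caseInr (.inr hw.eval) hv
  | iteTrue => exact .iteTrue .true hv
  | iteFalse => exact .iteFalse .false hv

theorem Step.eval {t t' v : Tm} (h : Step t t') (hv : Eval t' v) : Eval t v := by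
  obtain ⟨hE, hp⟩ := h
  induction hE generalizing v with
  | hole => exact hp.eval hv
  | app₁ _ ih => cases hv with | app h₁ h₂ h₃ => exact .app (ih h₁) h₂ h₃
  | app₂ _ _ ih => cases hv with | app h₁ h₂ h₃ => exact .app h₁ (ih h₂) h₃
  | fst _ ih => cases hv with | fst h => exact .fst (ih h)
  | snd _ ih => cases hv with | snd h => exact .snd (ih h)
  | pair₁ _ ih => cases hv with | pair h₁ h₂ => exact .pair (ih h₁) h₂
  | pair₂ _ _ ih => cases hv with | pair h₁ h₂ => exact .pair h₁ (ih h₂)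
  | case₁ _ ih =>
    cases hv with
    | caseInl h₁ h₂ => exact .caseInl (ih h₁) h₂
    | caseInr h₁ h₂ => exact .caseInr (ih h₁) h₂
  | inl _ ih => cases hv with | inl h => exact .inl (ih h)
  | inr _ ih => cases hv with | inr h => exact .inr (ih h)
  | seq₁ _ ih => cases hv with | seq h₁ h₂ => exact .seq (ih h₁) h₂
  | ite₁ _ ih =>
    cases hv with
    | iteTrue h₁ h₂ => exact .iteTrue (ih h₁) h₂
    | iteFalse h₁ h₂ => exact .iteFalse (ih h₁) h₂

open Relation (ReflTransGen)

theorem PrimStep.step {t t' : Tm} (h : PrimStep t t') : Step t t' := .ctx (E := .hole) .hole h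

/-- Reduction of the subterm in a frame. -/
theorem Step.frame (F : Ctx → Ctx) (f : Tm → Tm) (hF : ∀ E, E.IsEval → (F E).IsEval)
    (hf : ∀ E t, (F E).fill t = f (E.fill t)) {t t' : Tm} (h : ReflTransGen Step t t') :
    ReflTransGen Step (f t) (f t') := by
  refine h.lift f ?_
  rintro _ _ ⟨hE, hp⟩
  change Step (f _) (f _)
  rw [← hf, ← hf]
  exact .ctx (hF _ hE) hp

theorem Eval.steps {t v : Tm} (h : Eval t v) : ReflTransGen Step t v := by
  induction h with
  | unit | true | false | lam => exact .refl
  | @app τ t u b w v h₁ h₂ h₃ ih₁ ih₂ ih₃ =>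
    have h₁' := Step.frame (.app₁ · u) (.app · u) (fun _ h => .app₁ h) (fun _ _ => rfl) ih₁
    have h₂' := Step.frame (.app₂ (.lam τ b)) (.app (.lam τ b)) (fun _ h => .app₂ (.lam _ _) h)
      (fun _ _ => rfl) ih₂
    exact ((h₁'.trans h₂').tail (PrimStep.beta h₂.isValue).step).trans ih₃
  | fst h ih =>
    cases h.isValue
    exact (Step.frame .fst .fst (fun _ h => .fst h) (fun _ _ => rfl) ih).tail
      (PrimStep.fst ‹_› ‹_›).step
  | snd h ih =>
    cases h.isValue
    exact (Step.frame .snd .snd (fun _ h => .snd h) (fun _ _ => rfl) ih).tail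
      (PrimStep.snd ‹_› ‹_›).step
  | @pair t u v w h₁ h₂ ih₁ ih₂ =>
    have h₁' := Step.frame (.pair₁ · u) (.pair · u) (fun _ h => .pair₁ h) (fun _ _ => rfl) ih₁
    exact h₁'.trans (Step.frame (.pair₂ v) (.pair v) (fun _ h => .pair₂ h₁.isValue h)
      (fun _ _ => rfl) ih₂)
  | inl h ih => exact Step.frame .inl .inl (fun _ h => .inl h) (fun _ _ => rfl) ih
  | inr h ih => exact Step.frame .inr .inr (fun _ h => .inr h) (fun _ _ => rfl) ih
  | @caseInl t u₁ u₂ w v h₁ h₂ ih₁ ih₂ =>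
    cases h₁.isValue
    have h₁' := Step.frame (.case₁ · u₁ u₂) (.case · u₁ u₂) (fun _ h => .case₁ h)
      (fun _ _ => rfl) ih₁
    exact (h₁'.tail (PrimStep.inl ‹_›).step).trans ih₂
  | @caseInr t u₁ u₂ w v h₁ h₂ ih₁ ih₂ =>
    cases h₁.isValue
    have h₁' := Step.frame (.case₁ · u₁ u₂) (.case · u₁ u₂) (fun _ h => .case₁ h)
      (fun _ _ => rfl) ih₁
    exact (h₁'.tail (PrimStep.inr ‹_›).step).trans ih₂
  | @iteTrue t u₁ u₂ v h₁ h₂ ih₁ ih₂ =>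
    have h₁' := Step.frame (.ite₁ · u₁ u₂) (.ite · u₁ u₂) (fun _ h => .ite₁ h)
      (fun _ _ => rfl) ih₁
    exact (h₁'.tail PrimStep.iteTrue.step).trans ih₂
  | @iteFalse t u₁ u₂ v h₁ h₂ ih₁ ih₂ =>
    have h₁' := Step.frame (.ite₁ · u₁ u₂) (.ite · u₁ u₂) (fun _ h => .ite₁ h)
      (fun _ _ => rfl) ih₁
    exact (h₁'.tail PrimStep.iteFalse.step).trans ih₂
  | @seq t u v h₁ h₂ ih₁ ih₂ =>
    have h₁' := Step.frame (.seq₁ · u) (.seq · u) (fun _ h => .seq₁ h) (fun _ _ => rfl) ih₁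
    exact (h₁'.tail PrimStep.seq.step).trans ih₂

theorem terminates_iff_eval {t : Tm} : Terminates t ↔ ∃ v, Eval t v := by
  constructor
  · rintro ⟨n, v, h⟩
    refine ⟨v, ?_⟩
    induction h with
    | value hv => exact hv.eval
    | step hs _ ih => exact hs.eval ih
  · rintro ⟨v, h⟩
    have hv := h.isValue
    have hs := h.steps
    clear h
    induction hs using ReflTransGen.head_induction_on with
    | refl => exact ⟨0, v, .value hv⟩
    | head hs _ ih =>
      obtain ⟨n, w, hw⟩ := ih
      exact ⟨n + 1, w, .step hs hw⟩

end Equi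

namespace Iso

/-! ## Diverging terms -/

/-- The function `λ x : D. unfold x x`, where `D = μ α. (α → σ)`. -/
def selfApp (σ : Ty) : Tm :=
  .lam (.mu (.arr (.var 0) σ)) (.app (.unfold (.arr (.var 0) σ) (.var 0)) (.var 0))

/-- A closed diverging term of type `σ`. -/
def diverge (σ : Ty) : Tm := .app (selfApp σ) (.fold (.arr (.var 0) σ) (selfApp σ))

/-- Infinite descent: two beta steps lead back to the same instance of the body of `selfApp`, so
each derivation yields a strictly smaller one for the same term. -/
theorem not_bigStep_diverge (σ : Ty) (n : ℕ) (v : Tm) : ¬ BigStep n (diverge σ) v := by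
  induction n using Nat.strong_induction_on generalizing v with
  | _ n ih =>
    intro h
    cases h with | app h₁ h₂ h₃ =>
    cases h₁
    cases h₂ with | fold h₂ =>
    cases h₂
    cases h₃ with | app h₄ h₅ h₆ =>
    cases h₄ with | unfold h₄ =>
    cases h₄ with | fold h₄ =>
    cases h₄
    cases h₅ with | fold h₅ =>
    cases h₅
    exact ih _ (by omega) _ (BigStep.app .lam (.fold .lam) h₆)

theorem hasType_diverge {Γ : TyEnv} {σ : Ty} (hσ : σ.Valid) : HasType Γ (diverge σ) σ := by
  have hD : (Ty.mu (.arr (.var 0) σ)).Valid :=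
    ⟨⟨Nat.zero_lt_one, hσ.1.mono (Nat.zero_le _)⟩, .inl ⟨0, rfl⟩, .inr hσ.2⟩
  -- Since `σ` is closed, it could be placed under the `μ` without shifting, and the unrolling
  -- leaves it unchanged.
  have hu : Ty.unfoldMu (.arr (.var 0) σ) = .arr (.mu (.arr (.var 0) σ)) σ := by
    simp only [Ty.unfoldMu, Ty.subst, Ty.single]
    rw [hσ.1.subst_eq fun _ h => absurd h (Nat.not_lt_zero _)]
  have hs : HasType Γ (selfApp σ) (.arr (.mu (.arr (.var 0) σ)) σ) :=
    .lam hD (.app (hu ▸ .unfold hD (.var rfl)) (.var rfl))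
  exact .app hs (.fold hD (hu ▸ hs))

/-! ## Coercions between equal types -/

/-- `IsCast n τ σ c`: the closed term `c` is a function from `τ` to `σ` that only inserts and
removes `fold`s; below nesting depth `n` of the type constructors it may diverge. -/
inductive IsCast : ℕ → Ty → Ty → Tm → Prop
  | diverge {τ σ : Ty} : IsCast 0 τ σ (.lam τ (diverge σ))
  | unit {n : ℕ} : IsCast n .unit .unit (.lam .unit (.var 0))
  | bool {n : ℕ} : IsCast n .bool .bool (.lam .bool (.var 0))
  | arr {n : ℕ} {a b a' b' : Ty} {c₁ c₂ : Tm} : IsCast n a' a c₁ → IsCast n b b' c₂ →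
      IsCast (n + 1) (.arr a b) (.arr a' b')
        (.lam (.arr a b) (.lam a' (.app c₂ (.app (.var 1) (.app c₁ (.var 0))))))
  | prod {n : ℕ} {a b a' b' : Ty} {c₁ c₂ : Tm} : IsCast n a a' c₁ → IsCast n b b' c₂ →
      IsCast (n + 1) (.prod a b) (.prod a' b')
        (.lam (.prod a b) (.pair (.app c₁ (.fst (.var 0))) (.app c₂ (.snd (.var 0)))))
  | sum {n : ℕ} {a b a' b' : Ty} {c₁ c₂ : Tm} : IsCast n a a' c₁ → IsCast n b b' c₂ →
      IsCast (n + 1) (.sum a b) (.sum a' b')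
        (.lam (.sum a b)
          (.case (.var 0) (.inl (.app c₁ (.var 0))) (.inr (.app c₂ (.var 0)))))
  | muL {n : ℕ} {τ σ : Ty} {c : Tm} : IsCast n τ.unfoldMu σ c →
      IsCast n (.mu τ) σ (.lam (.mu τ) (.app c (.unfold τ (.var 0))))
  | muR {n : ℕ} {τ σ : Ty} {c : Tm} : IsCast n τ σ.unfoldMu c →
      IsCast n τ (.mu σ) (.lam τ (.fold σ (.app c (.var 0))))

namespace IsCast

variable {n : ℕ} {τ σ : Ty} {c : Tm}

theorem subst_eq (h : IsCast n τ σ c) (s : ℕ → Tm) : c.subst s = c := by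
  induction h generalizing s with
  | diverge | unit | bool => rfl
  | arr _ _ ih₁ ih₂ | prod _ _ ih₁ ih₂ | sum _ _ ih₁ ih₂ =>
    simp only [Tm.subst, Tm.liftSub, Tm.rename, ih₁, ih₂]
  | muL _ ih | muR _ ih => simp only [Tm.subst, Tm.liftSub, ih]

theorem rename_eq (h : IsCast n τ σ c) (ξ : ℕ → ℕ) : c.rename ξ = c := by
  induction h generalizing ξ with
  | diverge | unit | bool => rfl
  | arr _ _ ih₁ ih₂ | prod _ _ ih₁ ih₂ | sum _ _ ih₁ ih₂ =>
    simp only [Tm.rename, liftRen, ih₁, ih₂]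
  | muL _ ih | muR _ ih => simp only [Tm.rename, liftRen, ih]

theorem exists_eq_lam (h : IsCast n τ σ c) : ∃ b, c = .lam τ b := by cases h <;> exact ⟨_, rfl⟩

theorem hasType {Γ : TyEnv} (h : IsCast n τ σ c) (hτ : τ.Valid) (hσ : σ.Valid) :
    HasType Γ c (.arr τ σ) := by
  induction h generalizing Γ with
  | diverge => exact .lam hτ (hasType_diverge hσ)
  | unit | bool => exact .lam hτ (.var rfl)
  | arr _ _ ih₁ ih₂ =>
    obtain ⟨⟨ha, hb⟩, ha', hb'⟩ := And.intro (Ty.valid_arr.1 hτ) (Ty.valid_arr.1 hσ)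
    exact .lam hτ (.lam ha' (.app (ih₂ hb hb') (.app (.var rfl) (.app (ih₁ ha' ha) (.var rfl)))))
  | prod _ _ ih₁ ih₂ =>
    obtain ⟨⟨ha, hb⟩, ha', hb'⟩ := And.intro (Ty.valid_prod.1 hτ) (Ty.valid_prod.1 hσ)
    exact .lam hτ (.pair (.app (ih₁ ha ha') (.fst (.var rfl)))
      (.app (ih₂ hb hb') (.snd (.var rfl))))
  | sum _ _ ih₁ ih₂ =>
    obtain ⟨⟨ha, hb⟩, ha', hb'⟩ := And.intro (Ty.valid_sum.1 hτ) (Ty.valid_sum.1 hσ)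
    exact .lam hτ (.case (.var rfl) (.inl hb' (.app (ih₁ ha ha') (.var rfl)))
      (.inr ha' (.app (ih₂ hb hb') (.var rfl))))
  | muL _ ih => exact .lam hτ (.app (ih hτ.unfoldMu hσ) (.unfold hτ (.var rfl)))
  | muR _ ih => exact .lam hτ (.fold hσ (.app (ih hτ hσ.unfoldMu) (.var rfl)))

end IsCast

/-- Lexicographic induction on the depth and the number of leading `μ`s: a constructor lowers the
depth, and an unrolling keeps the depth but removes a leading `μ`. Both directions are built
together because a coercion of functions needs the reverse coercion on arguments. -/
theorem exists_isCast_of_equal {τ σ : Ty} (h : τ.Equal σ) (hτ : τ.Valid) (hσ : σ.Valid) (n : ℕ) :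
    (∃ c, IsCast n τ σ c) ∧ ∃ c, IsCast n σ τ c := by
  obtain ⟨R, hR, h⟩ := h
  induction n generalizing τ σ with
  | zero => exact ⟨⟨_, .diverge⟩, _, .diverge⟩
  | succ n ihn =>
    induction hk : τ.leadingMus + σ.leadingMus using Nat.strong_induction_on
      generalizing τ σ with
    | _ k ihk =>
      cases hR _ _ h with
      | unit => exact ⟨⟨_, .unit⟩, _, .unit⟩
      | bool => exact ⟨⟨_, .bool⟩, _, .bool⟩
      | var m => exact absurd hτ.1 (Nat.not_lt_zero m)
      | arr h₁ h₂ =>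
        obtain ⟨⟨ha, hb⟩, ha', hb'⟩ := And.intro (Ty.valid_arr.1 hτ) (Ty.valid_arr.1 hσ)
        obtain ⟨⟨_, h₁⟩, _, h₁'⟩ := ihn ha ha' h₁
        obtain ⟨⟨_, h₂⟩, _, h₂'⟩ := ihn hb hb' h₂
        exact ⟨⟨_, .arr h₁' h₂⟩, _, .arr h₁ h₂'⟩
      | prod h₁ h₂ =>
        obtain ⟨⟨ha, hb⟩, ha', hb'⟩ := And.intro (Ty.valid_prod.1 hτ) (Ty.valid_prod.1 hσ)
        obtain ⟨⟨_, h₁⟩, _, h₁'⟩ := ihn ha ha' h₁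
        obtain ⟨⟨_, h₂⟩, _, h₂'⟩ := ihn hb hb' h₂
        exact ⟨⟨_, .prod h₁ h₂⟩, _, .prod h₁' h₂'⟩
      | sum h₁ h₂ =>
        obtain ⟨⟨ha, hb⟩, ha', hb'⟩ := And.intro (Ty.valid_sum.1 hτ) (Ty.valid_sum.1 hσ)
        obtain ⟨⟨_, h₁⟩, _, h₁'⟩ := ihn ha ha' h₁
        obtain ⟨⟨_, h₂⟩, _, h₂'⟩ := ihn hb hb' h₂
        exact ⟨⟨_, .sum h₁ h₂⟩, _, .sum h₁' h₂'⟩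
      | muL h' =>
        have := hτ.leadingMus_unfoldMu
        obtain ⟨⟨_, h₁⟩, _, h₂⟩ := ihk _ (by omega) hτ.unfoldMu hσ h' rfl
        -- The source `σ` of the reverse coercion may itself be a `μ`-type. For this reason
        -- `IsCast.muR` lacks the side condition of the rule `muR` of type equality.
        exact ⟨⟨_, .muL h₁⟩, _, .muR h₂⟩
      | muR _ h' =>
        have := hσ.leadingMus_unfoldMu
        obtain ⟨⟨_, h₁⟩, _, h₂⟩ := ihk _ (by omega) hτ hσ.unfoldMu h' rfl
        exact ⟨⟨_, .muR h₁⟩, _, .muL h₂⟩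

end Iso

/-! ## Erasure up to coercions -/

/-- `ErasesTo L t u`: erasing `fold`s, `unfold`s, and applications of coercions from `t` gives `u`,
where all the coercions have at least depth `L`. -/
inductive ErasesTo (L : ℕ) : Iso.Tm → Equi.Tm → Prop
  | unit : ErasesTo L .unit .unit
  | true : ErasesTo L .true .true
  | false : ErasesTo L .false .false
  | var (n : ℕ) : ErasesTo L (.var n) (.var n)
  | lam {τ σ : Ty} {t : Iso.Tm} {u : Equi.Tm} : ErasesTo L t u → ErasesTo L (.lam τ t) (.lam σ u)
  | app {t₁ t₂ : Iso.Tm} {u₁ u₂ : Equi.Tm} :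
      ErasesTo L t₁ u₁ → ErasesTo L t₂ u₂ → ErasesTo L (.app t₁ t₂) (.app u₁ u₂)
  | fst {t : Iso.Tm} {u : Equi.Tm} : ErasesTo L t u → ErasesTo L (.fst t) (.fst u)
  | snd {t : Iso.Tm} {u : Equi.Tm} : ErasesTo L t u → ErasesTo L (.snd t) (.snd u)
  | pair {t₁ t₂ : Iso.Tm} {u₁ u₂ : Equi.Tm} :
      ErasesTo L t₁ u₁ → ErasesTo L t₂ u₂ → ErasesTo L (.pair t₁ t₂) (.pair u₁ u₂)
  | inl {t : Iso.Tm} {u : Equi.Tm} : ErasesTo L t u → ErasesTo L (.inl t) (.inl u)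
  | inr {t : Iso.Tm} {u : Equi.Tm} : ErasesTo L t u → ErasesTo L (.inr t) (.inr u)
  | case {t₁ t₂ t₃ : Iso.Tm} {u₁ u₂ u₃ : Equi.Tm} :
      ErasesTo L t₁ u₁ → ErasesTo L t₂ u₂ → ErasesTo L t₃ u₃ →
      ErasesTo L (.case t₁ t₂ t₃) (.case u₁ u₂ u₃)
  | ite {t₁ t₂ t₃ : Iso.Tm} {u₁ u₂ u₃ : Equi.Tm} :
      ErasesTo L t₁ u₁ → ErasesTo L t₂ u₂ → ErasesTo L t₃ u₃ →
      ErasesTo L (.ite t₁ t₂ t₃) (.ite u₁ u₂ u₃)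
  | seq {t₁ t₂ : Iso.Tm} {u₁ u₂ : Equi.Tm} :
      ErasesTo L t₁ u₁ → ErasesTo L t₂ u₂ → ErasesTo L (.seq t₁ t₂) (.seq u₁ u₂)
  | fold {τ : Ty} {t : Iso.Tm} {u : Equi.Tm} : ErasesTo L t u → ErasesTo L (.fold τ t) u
  | unfold {τ : Ty} {t : Iso.Tm} {u : Equi.Tm} : ErasesTo L t u → ErasesTo L (.unfold τ t) u
  | cast {n : ℕ} {τ σ : Ty} {c t : Iso.Tm} {u : Equi.Tm} :
      Iso.IsCast n τ σ c → L ≤ n → ErasesTo L t u → ErasesTo L (.app c t) u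
  /-- The value to which the coercion of a function value `f` evaluates. -/
  | wrap {n₁ n₂ : ℕ} {τ τ₁ σ₁ τ₂ σ₂ : Ty} {c₁ c₂ f : Iso.Tm} {u : Equi.Tm} :
      Iso.IsCast n₁ τ₁ σ₁ c₁ → L ≤ n₁ → Iso.IsCast n₂ τ₂ σ₂ c₂ → L ≤ n₂ → Iso.IsValue f →
      ErasesTo L f u →
      ErasesTo L (.lam τ (.app c₂ (.app (f.rename Nat.succ) (.app c₁ (.var 0))))) u

namespace ErasesTo

variable {L M : ℕ} {t : Iso.Tm} {u : Equi.Tm}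

theorem mono (h : ErasesTo L t u) (hM : M ≤ L) : ErasesTo M t u := by
  induction h with
  | unit => exact .unit
  | true => exact .true
  | false => exact .false
  | var n => exact .var n
  | lam _ ih => exact .lam ih
  | app _ _ ih₁ ih₂ => exact .app ih₁ ih₂
  | fst _ ih => exact .fst ih
  | snd _ ih => exact .snd ih
  | pair _ _ ih₁ ih₂ => exact .pair ih₁ ih₂
  | inl _ ih => exact .inl ih
  | inr _ ih => exact .inr ih
  | case _ _ _ ih₁ ih₂ ih₃ => exact .case ih₁ ih₂ ih₃
  | ite _ _ _ ih₁ ih₂ ih₃ => exact .ite ih₁ ih₂ ih₃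
  | seq _ _ ih₁ ih₂ => exact .seq ih₁ ih₂
  | fold _ ih => exact .fold ih
  | unfold _ ih => exact .unfold ih
  | cast hc hL _ ih => exact .cast hc (hM.trans hL) ih
  | wrap hc₁ hL₁ hc₂ hL₂ hf _ ih => exact .wrap hc₁ (hM.trans hL₁) hc₂ (hM.trans hL₂) hf ih

theorem rename (h : ErasesTo L t u) (ξ : ℕ → ℕ) : ErasesTo L (t.rename ξ) (u.rename ξ) := by
  induction h generalizing ξ with
  | unit => exact .unit
  | true => exact .true
  | false => exact .false
  | var n => exact .var _
  | lam _ ih => exact .lam (ih _)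
  | app _ _ ih₁ ih₂ => exact .app (ih₁ ξ) (ih₂ ξ)
  | fst _ ih => exact .fst (ih ξ)
  | snd _ ih => exact .snd (ih ξ)
  | pair _ _ ih₁ ih₂ => exact .pair (ih₁ ξ) (ih₂ ξ)
  | inl _ ih => exact .inl (ih ξ)
  | inr _ ih => exact .inr (ih ξ)
  | case _ _ _ ih₁ ih₂ ih₃ => exact .case (ih₁ ξ) (ih₂ _) (ih₃ _)
  | ite _ _ _ ih₁ ih₂ ih₃ => exact .ite (ih₁ ξ) (ih₂ ξ) (ih₃ ξ)
  | seq _ _ ih₁ ih₂ => exact .seq (ih₁ ξ) (ih₂ ξ)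
  | fold _ ih => exact .fold (ih ξ)
  | unfold _ ih => exact .unfold (ih ξ)
  | cast hc hL _ ih =>
    simp only [Iso.Tm.rename, hc.rename_eq]
    exact .cast hc hL (ih ξ)
  | wrap hc₁ hL₁ hc₂ hL₂ hf _ ih =>
    simp only [Iso.Tm.rename, hc₁.rename_eq, hc₂.rename_eq, Iso.Tm.rename_succ_rename]
    exact .wrap hc₁ hL₁ hc₂ hL₂ (hf.rename ξ) (ih ξ)

theorem subst (h : ErasesTo L t u) {s : ℕ → Iso.Tm} {r : ℕ → Equi.Tm}
    (hs : ∀ n, ErasesTo L (s n) (r n)) : ErasesTo L (t.subst s) (u.subst r) := by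
  have lift : ∀ {s : ℕ → Iso.Tm} {r : ℕ → Equi.Tm}, (∀ n, ErasesTo L (s n) (r n)) →
      ∀ n, ErasesTo L (Iso.Tm.liftSub s n) (Equi.Tm.liftSub r n) := by
    intro s r hs n
    cases n with
    | zero => exact .var 0
    | succ n => exact (hs n).rename _
  induction h generalizing s r with
  | unit => exact .unit
  | true => exact .true
  | false => exact .false
  | var n => exact hs n
  | lam _ ih => exact .lam (ih (lift hs))
  | app _ _ ih₁ ih₂ => exact .app (ih₁ hs) (ih₂ hs)
  | fst _ ih => exact .fst (ih hs)
  | snd _ ih => exact .snd (ih hs)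
  | pair _ _ ih₁ ih₂ => exact .pair (ih₁ hs) (ih₂ hs)
  | inl _ ih => exact .inl (ih hs)
  | inr _ ih => exact .inr (ih hs)
  | case _ _ _ ih₁ ih₂ ih₃ => exact .case (ih₁ hs) (ih₂ (lift hs)) (ih₃ (lift hs))
  | ite _ _ _ ih₁ ih₂ ih₃ => exact .ite (ih₁ hs) (ih₂ hs) (ih₃ hs)
  | seq _ _ ih₁ ih₂ => exact .seq (ih₁ hs) (ih₂ hs)
  | fold _ ih => exact .fold (ih hs)
  | unfold _ ih => exact .unfold (ih hs)
  | cast hc hL _ ih =>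
    simp only [Iso.Tm.subst, hc.subst_eq]
    exact .cast hc hL (ih hs)
  | wrap hc₁ hL₁ hc₂ hL₂ hf _ ih =>
    simp only [Iso.Tm.subst, hc₁.subst_eq, hc₂.subst_eq, Iso.Tm.subst_liftSub_rename_succ]
    exact .wrap hc₁ hL₁ hc₂ hL₂ (hf.subst s) (ih hs)

theorem inst {v : Iso.Tm} {w : Equi.Tm} (h : ErasesTo L t u) (hv : ErasesTo L v w) :
    ErasesTo L (t.inst v) (u.inst w) := by
  refine h.subst fun n => ?_
  cases n with
  | zero => exact hv
  | succ n => exact .var n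

/-- Only this direction holds: the application of a coercion is not a value but may erase to one. -/
theorem isValue (h : ErasesTo L t u) (ht : Iso.IsValue t) : Equi.IsValue u := by
  induction h with
  | unit => exact .unit
  | true => exact .true
  | false => exact .false
  | lam => exact .lam _ _
  | pair _ _ ih₁ ih₂ => cases ht with | pair h₁ h₂ => exact .pair (ih₁ h₁) (ih₂ h₂)
  | inl _ ih => cases ht with | inl h => exact .inl (ih h)
  | inr _ ih => cases ht with | inr h => exact .inr (ih h)
  | fold _ ih => cases ht with | fold h => exact ih h
  | wrap _ _ _ _ hf _ ih => exact ih hf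
  | _ => cases ht

end ErasesTo

/-- Plain erasure uses no coercion constructor, so the required depth is arbitrary. -/
theorem erasesTo_erase (L : ℕ) (t : Iso.Tm) : ErasesTo L t (erase t) := by
  induction t with
  | unit => exact .unit
  | true => exact .true
  | false => exact .false
  | var n => exact .var n
  | lam _ _ ih => exact .lam ih
  | app _ _ ih₁ ih₂ => exact .app ih₁ ih₂
  | fst _ ih => exact .fst ih
  | snd _ ih => exact .snd ih
  | pair _ _ ih₁ ih₂ => exact .pair ih₁ ih₂
  | inl _ ih => exact .inl ih
  | inr _ ih => exact .inr ih
  | case _ _ _ ih₁ ih₂ ih₃ => exact .case ih₁ ih₂ ih₃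
  | ite _ _ _ ih₁ ih₂ ih₃ => exact .ite ih₁ ih₂ ih₃
  | seq _ _ ih₁ ih₂ => exact .seq ih₁ ih₂
  | fold _ _ ih => exact .fold ih
  | unfold _ _ ih => exact .unfold ih

namespace Iso

theorem Eval.app_right {t u v w : Tm} (hu : Eval u w) (h : Eval (.app t w) v) :
    Eval (.app t u) v := by
  obtain ⟨n, h⟩ := h
  cases h with | app h₁ h₂ h₃ =>
  obtain rfl := h₂.eq_of_isValue hu.isValue
  exact .app ⟨_, h₁⟩ hu ⟨_, h₃⟩

/-- The argument has a smaller derivation, to which an induction on size applies. The application to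
its value comes without a size bound, because evaluating that value again has a cost;
`IsCast.erasesTo_of_bigStep` needs none. -/
theorem BigStep.app_arg {n : ℕ} {t u v : Tm} (h : BigStep n (.app t u) v) :
    ∃ m w, m < n ∧ BigStep m u w ∧ ∃ n', BigStep n' (.app t w) v := by
  cases h with | app h₁ h₂ h₃ =>
  obtain ⟨_, h⟩ := h₂.isValue.eval
  exact ⟨_, _, by omega, h₂, _, .app h₁ h h₃⟩

/-- The annotation of the outer `lam` fixes the domain. Typing an application of a coercion thus
gives its argument exactly the source type of the coercion. -/
theorem IsCast.dom_eq {n : ℕ} {τ σ a b : Ty} {c : Tm} {Γ : TyEnv} (h : IsCast n τ σ c)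
    (ht : HasType Γ c (.arr a b)) : a = τ := by
  obtain ⟨b, rfl⟩ := h.exists_eq_lam
  cases ht
  rfl

theorem inst_wrap {n₁ n₂ : ℕ} {τ₁ σ₁ τ₂ σ₂ : Ty} {c₁ c₂ : Tm} (hc₁ : IsCast n₁ τ₁ σ₁ c₁)
    (hc₂ : IsCast n₂ τ₂ σ₂ c₂) (f w : Tm) :
    Tm.inst (.app c₂ (.app (f.rename Nat.succ) (.app c₁ (.var 0)))) w =
      .app c₂ (.app f (.app c₁ w)) := by
  have hf := Tm.inst_rename_succ f w
  rw [Tm.inst] at hf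
  simp only [Tm.inst, Tm.subst, hc₁.subst_eq, hc₂.subst_eq, Tm.single, hf]

/-! ## Evaluation is preserved by erasure -/

/-- A coercion that returns at all returns a value with the same erasure; where it diverges there is
nothing to prove, so depth plays no role. The argument is a term rather than a value because
coercions at products and `μ`-types apply their component coercions to projections and `unfold`s. -/
theorem IsCast.erasesTo_of_bigStep {k n : ℕ} {τ σ : Ty} {c t w : Tm} {v : Equi.Tm}
    (hc : IsCast k τ σ c) (h : BigStep n (.app c t) w)
    (ht : ∀ m v', BigStep m t v' → ErasesTo 0 v' v) : ErasesTo 0 w v := by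
  induction hc generalizing n t w v with
  | diverge =>
    cases h with | app h₁ _ h₃ =>
    cases h₁
    exact absurd h₃ (not_bigStep_diverge _ _ _)
  | unit | bool =>
    cases h with | app h₁ h₂ h₃ =>
    cases h₁
    obtain rfl := h₃.eq_of_isValue h₂.isValue
    exact ht _ _ h₂
  | arr hc₁ hc₂ =>
    cases h with | app h₁ h₂ h₃ =>
    cases h₁
    simp only [Tm.inst, Tm.subst, Tm.liftSub, Tm.single, hc₁.subst_eq, hc₂.subst_eq] at h₃
    cases h₃
    exact .wrap hc₁ (Nat.zero_le _) hc₂ (Nat.zero_le _) h₂.isValue (ht _ _ h₂)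
  | prod hc₁ hc₂ ih₁ ih₂ =>
    cases h with | app h₁ h₂ h₃ =>
    cases h₁
    simp only [Tm.inst, Tm.subst, Tm.single, hc₁.subst_eq, hc₂.subst_eq] at h₃
    cases h₃ with | pair h₄ h₅ =>
    have hw := ht _ _ h₂
    obtain ⟨w₁, w₂, rfl⟩ : ∃ w₁ w₂, _ = Tm.pair w₁ w₂ := by
      cases h₄ with | app _ h _ =>
      cases h with | fst h => exact ⟨_, _, h.eq_of_isValue h₂.isValue⟩
    cases hw with | pair hw₁ hw₂ =>
    refine .pair (ih₁ h₄ fun m v' h => ?_) (ih₂ h₅ fun m v' h => ?_)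
    · cases h with | fst h =>
      cases h.eq_of_isValue h₂.isValue
      exact hw₁
    · cases h with | snd h =>
      cases h.eq_of_isValue h₂.isValue
      exact hw₂
  | sum hc₁ hc₂ ih₁ ih₂ =>
    cases h with | app h₁ h₂ h₃ =>
    cases h₁
    simp only [Tm.inst, Tm.subst, Tm.single, Tm.liftSub, hc₁.subst_eq, hc₂.subst_eq] at h₃
    have hw := ht _ _ h₂
    cases h₃ with
    | caseInl h₄ h₅ =>
      obtain rfl := h₄.eq_of_isValue h₂.isValue
      cases h₂.isValue with | inl hv =>
      cases hw with | inl hw =>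
      simp only [Tm.inst, Tm.subst, Tm.single, hc₁.subst_eq] at h₅
      cases h₅ with | inl h₅ =>
      exact .inl (ih₁ h₅ fun m v' h => h.eq_of_isValue hv ▸ hw)
    | caseInr h₄ h₅ =>
      obtain rfl := h₄.eq_of_isValue h₂.isValue
      cases h₂.isValue with | inr hv =>
      cases hw with | inr hw =>
      simp only [Tm.inst, Tm.subst, Tm.single, hc₂.subst_eq] at h₅
      cases h₅ with | inr h₅ =>
      exact .inr (ih₂ h₅ fun m v' h => h.eq_of_isValue hv ▸ hw)
  | muL hc ih =>
    cases h with | app h₁ h₂ h₃ =>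
    cases h₁
    simp only [Tm.inst, Tm.subst, Tm.single, hc.subst_eq] at h₃
    refine ih h₃ fun m v' h => ?_
    cases h with | unfold h =>
    obtain rfl := h.eq_of_isValue h₂.isValue
    cases ht _ _ h₂ with | fold h => exact h
  | muR hc ih =>
    cases h with | app h₁ h₂ h₃ =>
    cases h₁
    simp only [Tm.inst, Tm.subst, Tm.single, hc.subst_eq] at h₃
    cases h₃ with | fold h₃ =>
    exact .fold (ih h₃ fun m v' h => h.eq_of_isValue h₂.isValue ▸ ht _ _ h₂)

end Iso

theorem Equi.Eval.app_congr {t u v w x : Equi.Tm} (ht : Equi.Eval t v) (hu : Equi.Eval u w)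
    (h : Equi.Eval (.app v w) x) : Equi.Eval (.app t u) x := by
  cases h with | app h₁ h₂ h₃ =>
  obtain rfl := h₁.eq_of_isValue ht.isValue
  obtain rfl := h₂.eq_of_isValue hu.isValue
  exact .app ht hu h₃

theorem ErasesTo.eval_of_bigStep {n : ℕ} {t v : Iso.Tm} {u : Equi.Tm} (hr : ErasesTo 0 t u)
    (h : Iso.BigStep n t v) : ∃ w, Equi.Eval u w ∧ ErasesTo 0 v w := by
  induction n using Nat.strong_induction_on generalizing t v u with
  | _ n ih =>
    -- A function value is a plain abstraction, treated by the outer induction hypothesis, or a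
    -- wrapper. Applying a wrapper around `g` runs the body of `g` in a strictly smaller derivation,
    -- so an inner induction on the size `m` peels off nested wrappers, while both coercions leave
    -- erasures unchanged.
    have happ : ∀ m < n, ∀ {τ : Ty} {b x v : Iso.Tm} {f y : Equi.Tm},
        ErasesTo 0 (.lam τ b) f → ErasesTo 0 x y → Iso.IsValue x →
        Iso.BigStep m (b.inst x) v → ∃ w, Equi.Eval (.app f y) w ∧ ErasesTo 0 v w := by
      intro m
      induction m using Nat.strong_induction_on with
      | _ m ihm =>
        intro hm τ b x v f y hf hxy hx hb
        cases hf with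
        | lam hf =>
          obtain ⟨w, hw, hvw⟩ := ih m hm (hf.inst hxy) hb
          exact ⟨w, .app .lam (hxy.isValue hx).eval hw, hvw⟩
        | wrap hc₁ _ hc₂ _ hg hgf =>
          rw [Iso.inst_wrap hc₁ hc₂] at hb
          obtain ⟨k, y', hk, h₂, _, h₃⟩ := hb.app_arg
          have hy' := h₂.isValue
          cases h₂ with | app h₄ h₅ h₆ =>
          obtain rfl := h₄.eq_of_isValue hg
          obtain ⟨w, hw, hvw⟩ := ihm _ (by omega) (by omega) hgf
            (hc₁.erasesTo_of_bigStep h₅ fun _ _ h => h.eq_of_isValue hx ▸ hxy) h₅.isValue h₆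
          exact ⟨w, hw, hc₂.erasesTo_of_bigStep h₃ fun _ _ h => h.eq_of_isValue hy' ▸ hvw⟩
    cases hr with
    | unit => cases h; exact ⟨_, .unit, .unit⟩
    | true => cases h; exact ⟨_, .true, .true⟩
    | false => cases h; exact ⟨_, .false, .false⟩
    | var => cases h
    | lam hr => cases h; exact ⟨_, .lam, .lam hr⟩
    | app hr₁ hr₂ =>
      cases h with | app h₁ h₂ h₃ =>
      obtain ⟨w₁, hw₁, hr₁⟩ := ih _ (by omega) hr₁ h₁
      obtain ⟨w₂, hw₂, hr₂⟩ := ih _ (by omega) hr₂ h₂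
      obtain ⟨w, hw, hr⟩ := happ _ (by omega) hr₁ hr₂ h₂.isValue h₃
      exact ⟨w, hw₁.app_congr hw₂ hw, hr⟩
    | fst hr =>
      cases h with | fst h =>
      obtain ⟨w, hw, hr⟩ := ih _ (by omega) hr h
      cases hr with | pair hr₁ hr₂ => exact ⟨_, .fst hw, hr₁⟩
    | snd hr =>
      cases h with | snd h =>
      obtain ⟨w, hw, hr⟩ := ih _ (by omega) hr h
      cases hr with | pair hr₁ hr₂ => exact ⟨_, .snd hw, hr₂⟩
    | pair hr₁ hr₂ =>
      cases h with | pair h₁ h₂ =>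
      obtain ⟨w₁, hw₁, hr₁⟩ := ih _ (by omega) hr₁ h₁
      obtain ⟨w₂, hw₂, hr₂⟩ := ih _ (by omega) hr₂ h₂
      exact ⟨_, .pair hw₁ hw₂, .pair hr₁ hr₂⟩
    | inl hr =>
      cases h with | inl h =>
      obtain ⟨w, hw, hr⟩ := ih _ (by omega) hr h
      exact ⟨_, .inl hw, .inl hr⟩
    | inr hr =>
      cases h with | inr h =>
      obtain ⟨w, hw, hr⟩ := ih _ (by omega) hr h
      exact ⟨_, .inr hw, .inr hr⟩
    | case hr₁ hr₂ hr₃ =>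
      cases h with
      | caseInl h₁ h₂ =>
        obtain ⟨w₁, hw₁, hr₁⟩ := ih _ (by omega) hr₁ h₁
        cases hr₁ with | inl hr₁ =>
        obtain ⟨w, hw, hr⟩ := ih _ (by omega) (hr₂.inst hr₁) h₂
        exact ⟨w, .caseInl hw₁ hw, hr⟩
      | caseInr h₁ h₂ =>
        obtain ⟨w₁, hw₁, hr₁⟩ := ih _ (by omega) hr₁ h₁
        cases hr₁ with | inr hr₁ =>
        obtain ⟨w, hw, hr⟩ := ih _ (by omega) (hr₃.inst hr₁) h₂
        exact ⟨w, .caseInr hw₁ hw, hr⟩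
    | ite hr₁ hr₂ hr₃ =>
      cases h with
      | iteTrue h₁ h₂ =>
        obtain ⟨w₁, hw₁, hr₁⟩ := ih _ (by omega) hr₁ h₁
        cases hr₁
        obtain ⟨w, hw, hr⟩ := ih _ (by omega) hr₂ h₂
        exact ⟨w, .iteTrue hw₁ hw, hr⟩
      | iteFalse h₁ h₂ =>
        obtain ⟨w₁, hw₁, hr₁⟩ := ih _ (by omega) hr₁ h₁
        cases hr₁
        obtain ⟨w, hw, hr⟩ := ih _ (by omega) hr₃ h₂
        exact ⟨w, .iteFalse hw₁ hw, hr⟩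
    | seq hr₁ hr₂ =>
      cases h with | seq h₁ h₂ =>
      obtain ⟨w₁, hw₁, hr₁⟩ := ih _ (by omega) hr₁ h₁
      cases hr₁
      obtain ⟨w, hw, hr⟩ := ih _ (by omega) hr₂ h₂
      exact ⟨w, .seq hw₁ hw, hr⟩
    | fold hr =>
      cases h with | fold h =>
      obtain ⟨w, hw, hr⟩ := ih _ (by omega) hr h
      exact ⟨w, hw, .fold hr⟩
    | unfold hr =>
      cases h with | unfold h =>
      obtain ⟨w, hw, hr⟩ := ih _ (by omega) hr h
      cases hr with | fold hr => exact ⟨w, hw, hr⟩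
    | cast hc _ hr =>
      obtain ⟨m, x, hm, h₂, _, h₃⟩ := h.app_arg
      obtain ⟨w, hw, hr⟩ := ih m hm hr h₂
      exact ⟨w, hw, hc.erasesTo_of_bigStep h₃ fun _ _ h => h.eq_of_isValue h₂.isValue ▸ hr⟩
    | wrap hc₁ hL₁ hc₂ hL₂ hf hr =>
      cases h
      exact ⟨_, (hr.isValue hf).eval, .wrap hc₁ hL₁ hc₂ hL₂ hf hr⟩

/-! ## Evaluation is reflected by erasure -/

namespace Equi

/-- The size of a value, where functions count as atoms. -/
def Tm.size : Tm → ℕ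
  | .pair t u => size t + size u + 1
  | .inl t => size t + 1
  | .inr t => size t + 1
  | _ => 1

theorem Tm.size_pos (t : Tm) : 0 < t.size := by cases t <;> simp [Tm.size]

end Equi

/-- The coercion descends along the value, spending one unit of depth per pair or injection and one
at a function. A depth exceeding `L` by the size of the value thus never reaches the diverging part
and leaves depth `L` in the wrappers created. Typing ensures that the shape of the value matches the
coercion. -/
theorem Iso.IsCast.exists_eval {k L : ℕ} {τ σ : Ty} {c v : Iso.Tm} {w : Equi.Tm}
    (hc : IsCast k τ σ c) (hv : IsValue v) (ht : HasType [] v τ) (hr : ErasesTo L v w)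
    (hL : L + w.size ≤ k) : ∃ v', Eval (.app c v) v' ∧ ErasesTo L v' w := by
  induction hc generalizing v w with
  | diverge => exact absurd w.size_pos (by omega)
  | unit | bool => exact ⟨v, .app .lam hv.eval hv.eval, hr⟩
  | @arr _ _ _ a' _ _ _ hc₁ hc₂ =>
    have := w.size_pos
    -- The coercion has depth one more than `hc₁` and `hc₂`, and this unit is paid by the size of
    -- `w`, which is positive.
    refine ⟨_, .app .lam hv.eval ?_, .wrap (τ := a') hc₁ (by omega) hc₂ (by omega) hv hr⟩
    simp only [Tm.inst, Tm.subst, Tm.liftSub, Tm.single, hc₁.subst_eq, hc₂.subst_eq]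
    exact .lam
  | prod hc₁ hc₂ ih₁ ih₂ =>
    cases hv <;> cases ht
    rename_i hv₁ hv₂ ht₁ ht₂
    cases hr with | pair hr₁ hr₂ =>
    simp only [Equi.Tm.size] at hL
    obtain ⟨x₁, hx₁, hr₁⟩ := ih₁ hv₁ ht₁ hr₁ (by omega)
    obtain ⟨x₂, hx₂, hr₂⟩ := ih₂ hv₂ ht₂ hr₂ (by omega)
    have hp := (hv₁.pair hv₂).eval
    refine ⟨_, .app .lam hp ?_, .pair hr₁ hr₂⟩
    simp only [Tm.inst, Tm.subst, Tm.single, hc₁.subst_eq, hc₂.subst_eq]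
    exact .pair (.app_right hp.fst hx₁) (.app_right hp.snd hx₂)
  | sum hc₁ hc₂ ih₁ ih₂ =>
    have hve := hv.eval
    cases hv <;> cases ht
    · rename_i hv ht _
      cases hr with | inl hr =>
      simp only [Equi.Tm.size] at hL
      obtain ⟨x, hx, hr⟩ := ih₁ hv ht hr (by omega)
      refine ⟨_, .app .lam hve ?_, .inl hr⟩
      refine .caseInl hve ?_
      simp only [Tm.inst, Tm.subst, Tm.single, Tm.liftSub, hc₁.subst_eq]
      exact hx.inl
    · rename_i hv _ ht
      cases hr with | inr hr =>
      simp only [Equi.Tm.size] at hL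
      obtain ⟨x, hx, hr⟩ := ih₂ hv ht hr (by omega)
      refine ⟨_, .app .lam hve ?_, .inr hr⟩
      refine .caseInr hve ?_
      simp only [Tm.inst, Tm.subst, Tm.single, Tm.liftSub, hc₂.subst_eq]
      exact hx.inr
  | muL hc ih =>
    have hve := hv.eval
    cases hv <;> cases ht
    rename_i hv _ ht
    cases hr with | fold hr =>
    -- Unrolling uses no depth, and removing a `fold` leaves the erasure `w` unchanged, so the bound
    -- passes on as it is.
    obtain ⟨x, hx, hr⟩ := ih hv ht hr hL
    refine ⟨x, .app .lam hve ?_, hr⟩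
    simp only [Tm.inst, Tm.subst, Tm.single, hc.subst_eq]
    exact .app_right hve.unfold hx
  | @muR _ _ σ _ hc ih =>
    obtain ⟨x, hx, hr⟩ := ih hv ht hr hL
    refine ⟨_, .app .lam hv.eval ?_, .fold (τ := σ) hr⟩
    simp only [Tm.inst, Tm.subst, Tm.single, hc.subst_eq]
    exact hx.fold

/-- Every well-typed term that erases to `u` evaluates to a value that erases to `w`, if its
coercions are `k` deeper than those of the value have to be. -/
def ReflectsEval (k : ℕ) (u w : Equi.Tm) : Prop :=
  ∀ ⦃L : ℕ⦄ ⦃t : Iso.Tm⦄ ⦃τ : Ty⦄, Iso.HasType [] t τ → ErasesTo (L + k) t u →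
    ∃ v, Iso.Eval t v ∧ ErasesTo L v w

/-- `t` and `u` have the same head, and subterms related by `R`. -/
inductive SameHead (R : Iso.Tm → Equi.Tm → Prop) : Iso.Tm → Equi.Tm → Prop
  | unit : SameHead R .unit .unit
  | true : SameHead R .true .true
  | false : SameHead R .false .false
  | var (n : ℕ) : SameHead R (.var n) (.var n)
  | lam {τ σ : Ty} {t : Iso.Tm} {u : Equi.Tm} : R t u → SameHead R (.lam τ t) (.lam σ u)
  | app {t₁ t₂ : Iso.Tm} {u₁ u₂ : Equi.Tm} :
      R t₁ u₁ → R t₂ u₂ → SameHead R (.app t₁ t₂) (.app u₁ u₂)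
  | fst {t : Iso.Tm} {u : Equi.Tm} : R t u → SameHead R (.fst t) (.fst u)
  | snd {t : Iso.Tm} {u : Equi.Tm} : R t u → SameHead R (.snd t) (.snd u)
  | pair {t₁ t₂ : Iso.Tm} {u₁ u₂ : Equi.Tm} :
      R t₁ u₁ → R t₂ u₂ → SameHead R (.pair t₁ t₂) (.pair u₁ u₂)
  | inl {t : Iso.Tm} {u : Equi.Tm} : R t u → SameHead R (.inl t) (.inl u)
  | inr {t : Iso.Tm} {u : Equi.Tm} : R t u → SameHead R (.inr t) (.inr u)
  | case {t₁ t₂ t₃ : Iso.Tm} {u₁ u₂ u₃ : Equi.Tm} :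
      R t₁ u₁ → R t₂ u₂ → R t₃ u₃ → SameHead R (.case t₁ t₂ t₃) (.case u₁ u₂ u₃)
  | ite {t₁ t₂ t₃ : Iso.Tm} {u₁ u₂ u₃ : Equi.Tm} :
      R t₁ u₁ → R t₂ u₂ → R t₃ u₃ → SameHead R (.ite t₁ t₂ t₃) (.ite u₁ u₂ u₃)
  | seq {t₁ t₂ : Iso.Tm} {u₁ u₂ : Equi.Tm} :
      R t₁ u₁ → R t₂ u₂ → SameHead R (.seq t₁ t₂) (.seq u₁ u₂)

/-- It suffices to consider terms whose head is not a `fold`, `unfold` or coercion. -/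
theorem ReflectsEval.of_sameHead {k : ℕ} {u w : Equi.Tm} (huw : Equi.Eval u w)
    (h : ∀ ⦃L : ℕ⦄ ⦃t : Iso.Tm⦄ ⦃τ : Ty⦄, Iso.HasType [] t τ →
      SameHead (ErasesTo (L + k)) t u → ∃ v, Iso.Eval t v ∧ ErasesTo L v w) :
    ReflectsEval (k + w.size) u w := by
  intro L t τ ht hr
  have h' : ∀ ⦃t : Iso.Tm⦄ ⦃τ : Ty⦄, Iso.HasType [] t τ →
      SameHead (ErasesTo (L + (k + w.size))) t u → ∃ v, Iso.Eval t v ∧ ErasesTo L v w := by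
    intro t τ ht hc
    rw [show L + (k + w.size) = L + w.size + k by omega] at hc
    obtain ⟨v, hv, hr⟩ := h ht hc
    exact ⟨v, hv, hr.mono (Nat.le_add_right _ _)⟩
  clear h
  induction hr generalizing τ with
  | unit => exact h' ht .unit
  | true => exact h' ht .true
  | false => exact h' ht .false
  | var n => exact h' ht (.var n)
  | lam hr => exact h' ht (.lam hr)
  | app hr₁ hr₂ => exact h' ht (.app hr₁ hr₂)
  | fst hr => exact h' ht (.fst hr)
  | snd hr => exact h' ht (.snd hr)
  | pair hr₁ hr₂ => exact h' ht (.pair hr₁ hr₂)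
  | inl hr => exact h' ht (.inl hr)
  | inr hr => exact h' ht (.inr hr)
  | case hr₁ hr₂ hr₃ => exact h' ht (.case hr₁ hr₂ hr₃)
  | ite hr₁ hr₂ hr₃ => exact h' ht (.ite hr₁ hr₂ hr₃)
  | seq hr₁ hr₂ => exact h' ht (.seq hr₁ hr₂)
  | fold hr ih =>
    cases ht with | fold _ ht =>
    obtain ⟨v, hv, hr⟩ := ih huw ht h'
    exact ⟨_, hv.fold, .fold hr⟩
  | unfold hr ih =>
    cases ht with | unfold _ ht =>
    obtain ⟨v, hv, hr⟩ := ih huw ht h'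
    have hvt := hv.hasType ht
    cases hv.isValue <;> cases hvt
    cases hr with | fold hr => exact ⟨_, hv.unfold, hr⟩
  | cast hc hL hr ih =>
    cases ht with | app hct ht =>
    obtain rfl := hc.dom_eq hct
    obtain ⟨v, hv, hr⟩ := ih huw ht h'
    -- The value below the coercion is already related at depth `L`, and the coercion itself has at
    -- least `w.size` more. The result is again at depth `L`, so any number of stacked coercions
    -- costs `w.size` only once.
    obtain ⟨x, hx, hr⟩ := hc.exists_eval hv.isValue (hv.hasType ht) hr (by omega)
    exact ⟨x, hv.app_right hx, hr⟩
  -- A wrapper is a value whose erasure is a value too, so both sides have already finished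
  -- evaluating.
  | wrap hc₁ hL₁ hc₂ hL₂ hf hr ih =>
    obtain rfl := huw.eq_of_isValue (hr.isValue hf)
    exact ⟨_, .lam, .wrap hc₁ (by omega) hc₂ (by omega) hf (hr.mono (by omega))⟩

/-- Application of a function value, which may be wrapped in coercions. -/
theorem ReflectsEval.exists_eval_app {k L M : ℕ} {σ τ τ' : Ty} {b x w : Equi.Tm}
    (h : ReflectsEval k (b.inst x) w) {f y : Iso.Tm} (hM : L + k + x.size + w.size ≤ M)
    (hr : ErasesTo M f (.lam σ b)) (hf : Iso.IsValue f) (hft : Iso.HasType [] f (.arr τ τ'))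
    (hy : Iso.IsValue y) (hyt : Iso.HasType [] y τ) (hyx : ErasesTo (L + k) y x) :
    ∃ v, Iso.Eval (.app f y) v ∧ ErasesTo L v w := by
  generalize hu : Equi.Tm.lam σ b = u at hr
  -- Each wrapper layer coerces the argument, with depth at least `L + k + x.size`, and the result,
  -- with depth at least `L + w.size`. Neither changes the erasures `x` and `w`, so one bound `M`
  -- serves any number of layers.
  induction hr generalizing τ τ' y with
  | lam hr =>
    cases hu
    cases hft with | lam _ hb =>
    obtain ⟨v, hv, hvw⟩ := h (hb.inst hyt) ((hr.mono (by omega)).inst hyx)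
    exact ⟨v, .app .lam hy.eval hv, hvw⟩
  | wrap hc₁ hL₁ hc₂ hL₂ hg _ ih =>
    cases hft with | lam _ hb =>
    have hbt := hb.inst hyt
    rw [Iso.inst_wrap hc₁ hc₂] at hbt
    cases hbt with | app hc₂t hgt =>
    have hcg := hgt
    cases hgt with | app hgt hct =>
    have hcy := hct
    cases hct with | app hc₁t hyt =>
    obtain rfl := hc₁.dom_eq hc₁t
    obtain rfl := hc₂.dom_eq hc₂t
    obtain ⟨y', hy', hyx⟩ := hc₁.exists_eval hy hyt hyx (by omega)
    obtain ⟨v, hv, hvw⟩ := ih hg hgt hy'.isValue (hy'.hasType hcy) hyx hu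
    have hgv := Iso.Eval.app_right hy' hv
    obtain ⟨v', hv', hvw⟩ := hc₂.exists_eval hv.isValue (hgv.hasType hcg) hvw (by omega)
    refine ⟨v', .app .lam hy.eval ?_, hvw⟩
    rw [Iso.inst_wrap hc₁ hc₂]
    exact .app_right hgv hv'
  | fold => cases hft
  | unfold => cases hf
  | cast => cases hf
  | _ => cases hu

/-- Induction on the evaluation of `u`: the depth needed is the sum of the depths for the premises,
plus the sizes of the values through which coercions are pushed. The terms `t` are quantified after
`k`. Their typing guarantees that evaluated subterms have the canonical form that each elimination
expects. -/
theorem Equi.Eval.exists_reflectsEval {u w : Equi.Tm} (h : Equi.Eval u w) :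
    ∃ k, ReflectsEval k u w := by
  induction h with
  | unit =>
    refine ⟨0 + _, .of_sameHead .unit fun L t τ ht hc => ?_⟩
    cases hc
    exact ⟨_, .unit, .unit⟩
  | true =>
    refine ⟨0 + _, .of_sameHead .true fun L t τ ht hc => ?_⟩
    cases hc
    exact ⟨_, .true, .true⟩
  | false =>
    refine ⟨0 + _, .of_sameHead .false fun L t τ ht hc => ?_⟩
    cases hc
    exact ⟨_, .false, .false⟩
  | lam =>
    refine ⟨0 + _, .of_sameHead .lam fun L t τ ht hc => ?_⟩
    cases hc with | lam hr => exact ⟨_, .lam, .lam hr⟩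
  | @app _ _ _ _ x w h₁ h₂ h₃ ih₁ ih₂ ih₃ =>
    obtain ⟨k₁, ih₁⟩ := ih₁
    obtain ⟨k₂, ih₂⟩ := ih₂
    obtain ⟨k₃, ih₃⟩ := ih₃
    -- After `k₁` is spent on the function, `k₃ + x.size + w.size` must remain for its wrappers;
    -- after `k₂` is spent on the argument, `k₃` must remain for the body. The last summand is the
    -- `w.size` charged by `of_sameHead`.
    refine ⟨k₁ + k₂ + k₃ + x.size + w.size + _,
      .of_sameHead (.app h₁ h₂ h₃) fun L t τ ht hc => ?_⟩
    cases hc with | app hr₁ hr₂ =>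
    cases ht with | app ht₁ ht₂ =>
    obtain ⟨v₁, hv₁, hr₁⟩ := ih₁ (L := L + k₃ + x.size + w.size) ht₁ (hr₁.mono (by omega))
    obtain ⟨v₂, hv₂, hr₂⟩ := ih₂ (L := L + k₃) ht₂ (hr₂.mono (by omega))
    obtain ⟨v, hv, hr⟩ := ih₃.exists_eval_app le_rfl hr₁ hv₁.isValue (hv₁.hasType ht₁)
      hv₂.isValue (hv₂.hasType ht₂) hr₂
    refine ⟨v, ?_, hr⟩
    -- The evaluation obtained is that of the two values `v₁`, `v₂` applied to each other. Its last
    -- premise, the run of the body, is reused below the original function and argument.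
    obtain ⟨n, hv⟩ := hv
    cases hv with | app g₁ g₂ g₃ =>
    obtain rfl := g₁.eq_of_isValue hv₁.isValue
    obtain rfl := g₂.eq_of_isValue hv₂.isValue
    exact .app hv₁ hv₂ ⟨_, g₃⟩
  | fst h ih =>
    obtain ⟨k, ih⟩ := ih
    refine ⟨k + _, .of_sameHead (.fst h) fun L t τ ht hc => ?_⟩
    cases hc with | fst hr =>
    cases ht with | fst ht =>
    obtain ⟨v, hv, hr⟩ := ih ht hr
    have hvt := hv.hasType ht
    cases hv.isValue <;> cases hvt
    cases hr with | pair hr₁ hr₂ => exact ⟨_, hv.fst, hr₁⟩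
  | snd h ih =>
    obtain ⟨k, ih⟩ := ih
    refine ⟨k + _, .of_sameHead (.snd h) fun L t τ ht hc => ?_⟩
    cases hc with | snd hr =>
    cases ht with | snd ht =>
    obtain ⟨v, hv, hr⟩ := ih ht hr
    have hvt := hv.hasType ht
    cases hv.isValue <;> cases hvt
    cases hr with | pair hr₁ hr₂ => exact ⟨_, hv.snd, hr₂⟩
  | pair h₁ h₂ ih₁ ih₂ =>
    obtain ⟨k₁, ih₁⟩ := ih₁
    obtain ⟨k₂, ih₂⟩ := ih₂
    refine ⟨k₁ + k₂ + _, .of_sameHead (.pair h₁ h₂) fun L t τ ht hc => ?_⟩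
    cases hc with | pair hr₁ hr₂ =>
    cases ht with | pair ht₁ ht₂ =>
    obtain ⟨v₁, hv₁, hr₁⟩ := ih₁ (L := L) ht₁ (hr₁.mono (by omega))
    obtain ⟨v₂, hv₂, hr₂⟩ := ih₂ (L := L) ht₂ (hr₂.mono (by omega))
    exact ⟨_, hv₁.pair hv₂, .pair hr₁ hr₂⟩
  | inl h ih =>
    obtain ⟨k, ih⟩ := ih
    refine ⟨k + _, .of_sameHead (.inl h) fun L t τ ht hc => ?_⟩
    cases hc with | inl hr =>
    cases ht with | inl _ ht =>
    obtain ⟨v, hv, hr⟩ := ih ht hr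
    exact ⟨_, hv.inl, .inl hr⟩
  | inr h ih =>
    obtain ⟨k, ih⟩ := ih
    refine ⟨k + _, .of_sameHead (.inr h) fun L t τ ht hc => ?_⟩
    cases hc with | inr hr =>
    cases ht with | inr _ ht =>
    obtain ⟨v, hv, hr⟩ := ih ht hr
    exact ⟨_, hv.inr, .inr hr⟩
  | caseInl h₁ h₂ ih₁ ih₂ =>
    obtain ⟨k₁, ih₁⟩ := ih₁
    obtain ⟨k₂, ih₂⟩ := ih₂
    refine ⟨k₁ + k₂ + _, .of_sameHead (.caseInl h₁ h₂) fun L t τ ht hc => ?_⟩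
    cases hc with | case hr₁ hr₂ hr₃ =>
    cases ht with | case ht₁ ht₂ ht₃ =>
    obtain ⟨v₁, hv₁, hr₁⟩ := ih₁ (L := L + k₂) ht₁ (hr₁.mono (by omega))
    have hvt := hv₁.hasType ht₁
    cases hv₁.isValue <;> cases hvt <;> cases hr₁
    rename_i hvt _ hr₁
    obtain ⟨v, hv, hr⟩ := ih₂ (ht₂.inst hvt) ((hr₂.mono (by omega)).inst hr₁)
    exact ⟨v, hv₁.caseInl hv, hr⟩
  | caseInr h₁ h₂ ih₁ ih₂ =>
    obtain ⟨k₁, ih₁⟩ := ih₁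
    obtain ⟨k₂, ih₂⟩ := ih₂
    refine ⟨k₁ + k₂ + _, .of_sameHead (.caseInr h₁ h₂) fun L t τ ht hc => ?_⟩
    cases hc with | case hr₁ hr₂ hr₃ =>
    cases ht with | case ht₁ ht₂ ht₃ =>
    obtain ⟨v₁, hv₁, hr₁⟩ := ih₁ (L := L + k₂) ht₁ (hr₁.mono (by omega))
    have hvt := hv₁.hasType ht₁
    cases hv₁.isValue <;> cases hvt <;> cases hr₁
    rename_i hvt hr₁
    obtain ⟨v, hv, hr⟩ := ih₂ (ht₃.inst hvt) ((hr₃.mono (by omega)).inst hr₁)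
    exact ⟨v, hv₁.caseInr hv, hr⟩
  | iteTrue h₁ h₂ ih₁ ih₂ =>
    obtain ⟨k₁, ih₁⟩ := ih₁
    obtain ⟨k₂, ih₂⟩ := ih₂
    refine ⟨k₁ + k₂ + _, .of_sameHead (.iteTrue h₁ h₂) fun L t τ ht hc => ?_⟩
    cases hc with | ite hr₁ hr₂ hr₃ =>
    cases ht with | ite ht₁ ht₂ ht₃ =>
    obtain ⟨v₁, hv₁, hr₁⟩ := ih₁ (L := L) ht₁ (hr₁.mono (by omega))
    have hvt := hv₁.hasType ht₁
    cases hv₁.isValue <;> cases hvt <;> cases hr₁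
    obtain ⟨v, hv, hr⟩ := ih₂ (L := L) ht₂ (hr₂.mono (by omega))
    exact ⟨v, hv₁.iteTrue hv, hr⟩
  | iteFalse h₁ h₂ ih₁ ih₂ =>
    obtain ⟨k₁, ih₁⟩ := ih₁
    obtain ⟨k₂, ih₂⟩ := ih₂
    refine ⟨k₁ + k₂ + _, .of_sameHead (.iteFalse h₁ h₂) fun L t τ ht hc => ?_⟩
    cases hc with | ite hr₁ hr₂ hr₃ =>
    cases ht with | ite ht₁ ht₂ ht₃ =>
    obtain ⟨v₁, hv₁, hr₁⟩ := ih₁ (L := L) ht₁ (hr₁.mono (by omega))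
    have hvt := hv₁.hasType ht₁
    cases hv₁.isValue <;> cases hvt <;> cases hr₁
    obtain ⟨v, hv, hr⟩ := ih₂ (L := L) ht₃ (hr₃.mono (by omega))
    exact ⟨v, hv₁.iteFalse hv, hr⟩
  | seq h₁ h₂ ih₁ ih₂ =>
    obtain ⟨k₁, ih₁⟩ := ih₁
    obtain ⟨k₂, ih₂⟩ := ih₂
    refine ⟨k₁ + k₂ + _, .of_sameHead (.seq h₁ h₂) fun L t τ ht hc => ?_⟩
    cases hc with | seq hr₁ hr₂ =>
    cases ht with | seq ht₁ ht₂ =>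
    obtain ⟨v₁, hv₁, hr₁⟩ := ih₁ (L := L) ht₁ (hr₁.mono (by omega))
    have hvt := hv₁.hasType ht₁
    cases hv₁.isValue <;> cases hvt
    obtain ⟨v, hv, hr⟩ := ih₂ (L := L) ht₂ (hr₂.mono (by omega))
    exact ⟨v, hv₁.seq hv, hr⟩

/-! ### Transfer of termination along erasure -/

theorem terminates_of_erasesTo {L : ℕ} {t : Iso.Tm} {u : Equi.Tm} (h : ErasesTo L t u)
    (ht : Iso.Terminates t) : Equi.Terminates u := by
  obtain ⟨v, n, hv⟩ := Iso.terminates_iff_eval.1 ht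
  obtain ⟨w, hw, _⟩ := (h.mono (Nat.zero_le L)).eval_of_bigStep hv
  exact Equi.terminates_iff_eval.2 ⟨w, hw⟩

/-- A term that erases to a terminating term up to deep enough coercions terminates. -/
theorem exists_terminates_of_erasesTo {u : Equi.Tm} (hu : Equi.Terminates u) :
    ∃ k, ∀ (t : Iso.Tm) (τ : Ty), Iso.HasType [] t τ → ErasesTo k t u → Iso.Terminates t := by
  obtain ⟨w, hw⟩ := Equi.terminates_iff_eval.1 hu
  obtain ⟨k, hk⟩ := hw.exists_reflectsEval
  refine ⟨k, fun t τ ht hr => ?_⟩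
  obtain ⟨v, hv, _⟩ := hk (L := 0) ht (hr.mono (by omega))
  exact Iso.terminates_iff_eval.2 ⟨v, hv⟩

/-! ## Back-translation -/

theorem ErasesTo.exists_cast {Γ : TyEnv} {τ σ : Ty} (h : τ.Equal σ) (hτ : τ.Valid)
    (hσ : σ.Valid) (L : ℕ) :
    ∃ c, Iso.HasType Γ c (.arr τ σ) ∧ ∀ t u, ErasesTo L t u → ErasesTo L (.app c t) u := by
  obtain ⟨c, hc⟩ := (Iso.exists_isCast_of_equal h hτ hσ L).1
  exact ⟨c, hc.hasType hτ hσ, fun _ _ h => .cast hc le_rfl h⟩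

/-- By recursion on the typing derivation rather than on the term: each use of the equality rule
becomes an application of a coercion of depth `L`, and every other rule is copied. -/
theorem Equi.HasType.exists_erasesTo {Γ : TyEnv} {u : Equi.Tm} {τ : Ty}
    (h : Equi.HasType Γ u τ) (hΓ : TyEnv.Valid Γ) (L : ℕ) :
    ∃ t, Iso.HasType Γ t τ ∧ ErasesTo L t u := by
  induction h with
  | var h => exact ⟨_, .var h, .var _⟩
  | unit => exact ⟨_, .unit, .unit⟩
  | true => exact ⟨_, .true, .true⟩
  | false => exact ⟨_, .false, .false⟩
  | lam hv _ ih =>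
    obtain ⟨t, ht, hr⟩ := ih (.cons hv hΓ)
    exact ⟨_, .lam hv ht, .lam hr⟩
  | app _ _ ih₁ ih₂ =>
    obtain ⟨t₁, ht₁, hr₁⟩ := ih₁ hΓ
    obtain ⟨t₂, ht₂, hr₂⟩ := ih₂ hΓ
    exact ⟨_, .app ht₁ ht₂, .app hr₁ hr₂⟩
  | fst _ ih =>
    obtain ⟨t, ht, hr⟩ := ih hΓ
    exact ⟨_, .fst ht, .fst hr⟩
  | snd _ ih =>
    obtain ⟨t, ht, hr⟩ := ih hΓ
    exact ⟨_, .snd ht, .snd hr⟩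
  | pair _ _ ih₁ ih₂ =>
    obtain ⟨t₁, ht₁, hr₁⟩ := ih₁ hΓ
    obtain ⟨t₂, ht₂, hr₂⟩ := ih₂ hΓ
    exact ⟨_, .pair ht₁ ht₂, .pair hr₁ hr₂⟩
  | inl hv _ ih =>
    obtain ⟨t, ht, hr⟩ := ih hΓ
    exact ⟨_, .inl hv ht, .inl hr⟩
  | inr hv _ ih =>
    obtain ⟨t, ht, hr⟩ := ih hΓ
    exact ⟨_, .inr hv ht, .inr hr⟩
  | case h _ _ ih₁ ih₂ ih₃ =>
    obtain ⟨hv₁, hv₂⟩ := Ty.valid_sum.1 (h.valid hΓ)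
    obtain ⟨t₁, ht₁, hr₁⟩ := ih₁ hΓ
    obtain ⟨t₂, ht₂, hr₂⟩ := ih₂ (.cons hv₁ hΓ)
    obtain ⟨t₃, ht₃, hr₃⟩ := ih₃ (.cons hv₂ hΓ)
    exact ⟨_, .case ht₁ ht₂ ht₃, .case hr₁ hr₂ hr₃⟩
  | ite _ _ _ ih₁ ih₂ ih₃ =>
    obtain ⟨t₁, ht₁, hr₁⟩ := ih₁ hΓ
    obtain ⟨t₂, ht₂, hr₂⟩ := ih₂ hΓ
    obtain ⟨t₃, ht₃, hr₃⟩ := ih₃ hΓ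
    exact ⟨_, .ite ht₁ ht₂ ht₃, .ite hr₁ hr₂ hr₃⟩
  | seq _ _ ih₁ ih₂ =>
    obtain ⟨t₁, ht₁, hr₁⟩ := ih₁ hΓ
    obtain ⟨t₂, ht₂, hr₂⟩ := ih₂ hΓ
    exact ⟨_, .seq ht₁ ht₂, .seq hr₁ hr₂⟩
  | eq hv h heq ih =>
    obtain ⟨t, ht, hr⟩ := ih hΓ
    obtain ⟨c, hct, hc⟩ := ErasesTo.exists_cast heq (h.valid hΓ) hv L
    exact ⟨_, .app hct ht, hc _ _ hr⟩

/-- As for terms, the equality rule becomes a coercion frame `app₂ c D`. The same `D` serves all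
fillings, so related terms can be plugged in separately. -/
theorem Equi.CtxType.exists_erasesTo {Γ₀ Γ : TyEnv} {τ₀ τ : Ty} {C : Equi.Ctx}
    (h : Equi.CtxType Γ₀ τ₀ C Γ τ) (hτ₀ : τ₀.Valid) (hΓ : TyEnv.Valid Γ) (L : ℕ) :
    ∃ D, Iso.CtxType Γ₀ τ₀ D Γ τ ∧
      ∀ t u, ErasesTo L t u → ErasesTo L (D.fill t) (C.fill u) := by
  induction h with
  | hole => exact ⟨.hole, .hole, fun _ _ h => h⟩
  | lam hv _ ih =>
    obtain ⟨D, hD, hr⟩ := ih (.cons hv hΓ)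
    exact ⟨_, .lam hv hD, fun t u h => .lam (hr t u h)⟩
  | app₁ _ hu ih =>
    obtain ⟨D, hD, hr⟩ := ih hΓ
    obtain ⟨x, hx, hxr⟩ := hu.exists_erasesTo hΓ L
    exact ⟨_, .app₁ hD hx, fun t u h => .app (hr t u h) hxr⟩
  | app₂ hu _ ih =>
    obtain ⟨D, hD, hr⟩ := ih hΓ
    obtain ⟨x, hx, hxr⟩ := hu.exists_erasesTo hΓ L
    exact ⟨_, .app₂ hx hD, fun t u h => .app hxr (hr t u h)⟩
  | fst _ ih =>
    obtain ⟨D, hD, hr⟩ := ih hΓ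
    exact ⟨_, .fst hD, fun t u h => .fst (hr t u h)⟩
  | snd _ ih =>
    obtain ⟨D, hD, hr⟩ := ih hΓ
    exact ⟨_, .snd hD, fun t u h => .snd (hr t u h)⟩
  | pair₁ _ hu ih =>
    obtain ⟨D, hD, hr⟩ := ih hΓ
    obtain ⟨x, hx, hxr⟩ := hu.exists_erasesTo hΓ L
    exact ⟨_, .pair₁ hD hx, fun t u h => .pair (hr t u h) hxr⟩
  | pair₂ hu _ ih =>
    obtain ⟨D, hD, hr⟩ := ih hΓ
    obtain ⟨x, hx, hxr⟩ := hu.exists_erasesTo hΓ L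
    exact ⟨_, .pair₂ hx hD, fun t u h => .pair hxr (hr t u h)⟩
  | case₁ hC hu hw ih =>
    obtain ⟨hv₁, hv₂⟩ := Ty.valid_sum.1 (hC.valid hτ₀ hΓ)
    obtain ⟨D, hD, hr⟩ := ih hΓ
    obtain ⟨x, hx, hxr⟩ := hu.exists_erasesTo (.cons hv₁ hΓ) L
    obtain ⟨y, hy, hyr⟩ := hw.exists_erasesTo (.cons hv₂ hΓ) L
    exact ⟨_, .case₁ hD hx hy, fun t u h => .case (hr t u h) hxr hyr⟩
  | case₂ hu _ hw ih =>
    obtain ⟨hv₁, hv₂⟩ := Ty.valid_sum.1 (hu.valid hΓ)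
    obtain ⟨x, hx, hxr⟩ := hu.exists_erasesTo hΓ L
    obtain ⟨D, hD, hr⟩ := ih (.cons hv₁ hΓ)
    obtain ⟨y, hy, hyr⟩ := hw.exists_erasesTo (.cons hv₂ hΓ) L
    exact ⟨_, .case₂ hx hD hy, fun t u h => .case hxr (hr t u h) hyr⟩
  | case₃ hu hw _ ih =>
    obtain ⟨hv₁, hv₂⟩ := Ty.valid_sum.1 (hu.valid hΓ)
    obtain ⟨x, hx, hxr⟩ := hu.exists_erasesTo hΓ L
    obtain ⟨y, hy, hyr⟩ := hw.exists_erasesTo (.cons hv₁ hΓ) L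
    obtain ⟨D, hD, hr⟩ := ih (.cons hv₂ hΓ)
    exact ⟨_, .case₃ hx hy hD, fun t u h => .case hxr hyr (hr t u h)⟩
  | inl hv _ ih =>
    obtain ⟨D, hD, hr⟩ := ih hΓ
    exact ⟨_, .inl hv hD, fun t u h => .inl (hr t u h)⟩
  | inr hv _ ih =>
    obtain ⟨D, hD, hr⟩ := ih hΓ
    exact ⟨_, .inr hv hD, fun t u h => .inr (hr t u h)⟩
  | seq₁ _ hu ih =>
    obtain ⟨D, hD, hr⟩ := ih hΓ
    obtain ⟨x, hx, hxr⟩ := hu.exists_erasesTo hΓ L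
    exact ⟨_, .seq₁ hD hx, fun t u h => .seq (hr t u h) hxr⟩
  | seq₂ hu _ ih =>
    obtain ⟨D, hD, hr⟩ := ih hΓ
    obtain ⟨x, hx, hxr⟩ := hu.exists_erasesTo hΓ L
    exact ⟨_, .seq₂ hx hD, fun t u h => .seq hxr (hr t u h)⟩
  | ite₁ _ hu hw ih =>
    obtain ⟨D, hD, hr⟩ := ih hΓ
    obtain ⟨x, hx, hxr⟩ := hu.exists_erasesTo hΓ L
    obtain ⟨y, hy, hyr⟩ := hw.exists_erasesTo hΓ L
    exact ⟨_, .ite₁ hD hx hy, fun t u h => .ite (hr t u h) hxr hyr⟩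
  | ite₂ hu _ hw ih =>
    obtain ⟨D, hD, hr⟩ := ih hΓ
    obtain ⟨x, hx, hxr⟩ := hu.exists_erasesTo hΓ L
    obtain ⟨y, hy, hyr⟩ := hw.exists_erasesTo hΓ L
    exact ⟨_, .ite₂ hx hD hy, fun t u h => .ite hxr (hr t u h) hyr⟩
  | ite₃ hu hw _ ih =>
    obtain ⟨D, hD, hr⟩ := ih hΓ
    obtain ⟨x, hx, hxr⟩ := hu.exists_erasesTo hΓ L
    obtain ⟨y, hy, hyr⟩ := hw.exists_erasesTo hΓ L
    exact ⟨_, .ite₃ hx hy hD, fun t u h => .ite hxr hyr (hr t u h)⟩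
  | eq hv hC heq ih =>
    obtain ⟨D, hD, hr⟩ := ih hΓ
    obtain ⟨c, hct, hc⟩ := ErasesTo.exists_cast heq (hC.valid hτ₀ hΓ) hv L
    exact ⟨.app₂ c D, .app₂ hct hD, fun t u h => hc _ _ (hr t u h)⟩

/-! ## Erasure preserves typing -/

theorem Iso.HasType.erase {Γ : TyEnv} {t : Iso.Tm} {τ : Ty} (h : Iso.HasType Γ t τ) :
    Equi.HasType Γ (erase t) τ := by
  induction h with
  | var h => exact .var h
  | unit => exact .unit
  | true => exact .true
  | false => exact .false
  | lam hv _ ih => exact .lam hv ih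
  | app _ _ ih₁ ih₂ => exact .app ih₁ ih₂
  | fst _ ih => exact .fst ih
  | snd _ ih => exact .snd ih
  | pair _ _ ih₁ ih₂ => exact .pair ih₁ ih₂
  | inl hv _ ih => exact .inl hv ih
  | inr hv _ ih => exact .inr hv ih
  | case _ _ _ ih₁ ih₂ ih₃ => exact .case ih₁ ih₂ ih₃
  | ite _ _ _ ih₁ ih₂ ih₃ => exact .ite ih₁ ih₂ ih₃
  | seq _ _ ih₁ ih₂ => exact .seq ih₁ ih₂
  | fold hv _ ih => exact .eq hv ih hv.unfoldMu_equal
  | unfold hv _ ih => exact .eq hv.unfoldMu ih hv.equal_unfoldMu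

/-- The frames `fold` and `unfold` vanish, and their typing steps become uses of the equality rule
between a `μ`-type and its unrolling. -/
theorem Iso.CtxType.exists_erase {Γ₀ Γ : TyEnv} {τ₀ τ : Ty} {C : Iso.Ctx}
    (h : Iso.CtxType Γ₀ τ₀ C Γ τ) :
    ∃ D, Equi.CtxType Γ₀ τ₀ D Γ τ ∧ ∀ t, D.fill (_root_.erase t) = _root_.erase (C.fill t) := by
  induction h with
  | hole => exact ⟨.hole, .hole, fun _ => rfl⟩
  | lam hv _ ih =>
    obtain ⟨D, hD, hf⟩ := ih
    exact ⟨_, .lam hv hD, fun t => congrArg _ (hf t)⟩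
  | app₁ _ hu ih =>
    obtain ⟨D, hD, hf⟩ := ih
    exact ⟨_, .app₁ hD hu.erase, fun t => congrArg (Equi.Tm.app · _) (hf t)⟩
  | app₂ hu _ ih =>
    obtain ⟨D, hD, hf⟩ := ih
    exact ⟨_, .app₂ hu.erase hD, fun t => congrArg _ (hf t)⟩
  | fst _ ih =>
    obtain ⟨D, hD, hf⟩ := ih
    exact ⟨_, .fst hD, fun t => congrArg _ (hf t)⟩
  | snd _ ih =>
    obtain ⟨D, hD, hf⟩ := ih
    exact ⟨_, .snd hD, fun t => congrArg _ (hf t)⟩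
  | pair₁ _ hu ih =>
    obtain ⟨D, hD, hf⟩ := ih
    exact ⟨_, .pair₁ hD hu.erase, fun t => congrArg (Equi.Tm.pair · _) (hf t)⟩
  | pair₂ hu _ ih =>
    obtain ⟨D, hD, hf⟩ := ih
    exact ⟨_, .pair₂ hu.erase hD, fun t => congrArg _ (hf t)⟩
  | case₁ _ hu hw ih =>
    obtain ⟨D, hD, hf⟩ := ih
    exact ⟨_, .case₁ hD hu.erase hw.erase, fun t => congrArg (Equi.Tm.case · _ _) (hf t)⟩
  | case₂ hu _ hw ih =>
    obtain ⟨D, hD, hf⟩ := ih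
    exact ⟨_, .case₂ hu.erase hD hw.erase, fun t => congrArg (Equi.Tm.case _ · _) (hf t)⟩
  | case₃ hu hw _ ih =>
    obtain ⟨D, hD, hf⟩ := ih
    exact ⟨_, .case₃ hu.erase hw.erase hD, fun t => congrArg _ (hf t)⟩
  | inl hv _ ih =>
    obtain ⟨D, hD, hf⟩ := ih
    exact ⟨_, .inl hv hD, fun t => congrArg _ (hf t)⟩
  | inr hv _ ih =>
    obtain ⟨D, hD, hf⟩ := ih
    exact ⟨_, .inr hv hD, fun t => congrArg _ (hf t)⟩
  | seq₁ _ hu ih =>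
    obtain ⟨D, hD, hf⟩ := ih
    exact ⟨_, .seq₁ hD hu.erase, fun t => congrArg (Equi.Tm.seq · _) (hf t)⟩
  | seq₂ hu _ ih =>
    obtain ⟨D, hD, hf⟩ := ih
    exact ⟨_, .seq₂ hu.erase hD, fun t => congrArg _ (hf t)⟩
  | ite₁ _ hu hw ih =>
    obtain ⟨D, hD, hf⟩ := ih
    exact ⟨_, .ite₁ hD hu.erase hw.erase, fun t => congrArg (Equi.Tm.ite · _ _) (hf t)⟩
  | ite₂ hu _ hw ih =>
    obtain ⟨D, hD, hf⟩ := ih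
    exact ⟨_, .ite₂ hu.erase hD hw.erase, fun t => congrArg (Equi.Tm.ite _ · _) (hf t)⟩
  | ite₃ hu hw _ ih =>
    obtain ⟨D, hD, hf⟩ := ih
    exact ⟨_, .ite₃ hu.erase hw.erase hD, fun t => congrArg _ (hf t)⟩
  | fold hv _ ih =>
    obtain ⟨D, hD, hf⟩ := ih
    exact ⟨D, .eq hv hD hv.unfoldMu_equal, hf⟩
  | unfold hv _ ih =>
    obtain ⟨D, hD, hf⟩ := ih
    exact ⟨D, .eq hv.unfoldMu hD hv.equal_unfoldMu, hf⟩

/-! ## Full abstraction -/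

/-- Both simulations apply to plain erasure, where the depth `k` demanded by the run of `erase t` is
available for free. -/
theorem terminates_erase_iff {t : Iso.Tm} {τ : Ty} (ht : Iso.HasType [] t τ) :
    Equi.Terminates (erase t) ↔ Iso.Terminates t := by
  refine ⟨fun h => ?_, terminates_of_erasesTo (erasesTo_erase 0 t)⟩
  obtain ⟨k, hk⟩ := exists_terminates_of_erasesTo h
  exact hk t τ ht (erasesTo_erase k t)

theorem mainTheorem2 (t₁ t₂ : Iso.Tm) (τ : Ty)
    (ht₁ : Iso.HasType [] t₁ τ) (ht₂ : Iso.HasType [] t₂ τ) :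
    Iso.CtxEquiv [] t₁ t₂ τ ↔ Equi.CtxEquiv [] (erase t₁) (erase t₂) τ := by
  constructor
  · rintro ⟨_, _, h⟩
    have transfer : ∀ {s₁ s₂ : Iso.Tm}, Iso.HasType [] s₁ τ →
        (∀ C τ', Iso.CtxType [] τ C [] τ' →
          Iso.Terminates (C.fill s₁) → Iso.Terminates (C.fill s₂)) →
        ∀ C τ', Equi.CtxType [] τ C [] τ' →
          Equi.Terminates (C.fill (erase s₁)) → Equi.Terminates (C.fill (erase s₂)) := by
      intro s₁ s₂ hs₁ h C τ' hC hterm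
      -- The depth is read off the run of `C[erase s₁]` before the back-translation `D` is chosen.
      -- The return from `D[s₂]` to `C[erase s₂]` needs no condition on the depth.
      obtain ⟨k, hk⟩ := exists_terminates_of_erasesTo hterm
      obtain ⟨D, hD, hr⟩ := hC.exists_erasesTo (ht₁.valid TyEnv.valid_nil) TyEnv.valid_nil k
      have h₁ := hk _ _ (hD.fill hs₁) (hr _ _ (erasesTo_erase k s₁))
      exact terminates_of_erasesTo (hr _ _ (erasesTo_erase k s₂)) (h D τ' hD h₁)
    exact ⟨ht₁.erase, ht₂.erase, fun C τ' hC =>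
      ⟨transfer ht₁ (fun D τ' hD => (h D τ' hD).1) C τ' hC,
        transfer ht₂ (fun D τ' hD => (h D τ' hD).2) C τ' hC⟩⟩
  · rintro ⟨_, _, h⟩
    refine ⟨ht₁, ht₂, fun C τ' hC => ?_⟩
    obtain ⟨D, hD, hf⟩ := hC.exists_erase
    rw [← terminates_erase_iff (hC.fill ht₁), ← terminates_erase_iff (hC.fill ht₂), ← hf, ← hf]
    exact h D τ' hD
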